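/- Let $k\ge 1$, let $M_k$ be the space of complex $k\times k$ matrices with its Borel $\sigma$-algebra and norm $\|A\|^2=\mathrm{tr}(AA^\dagger)$, and let $\mu\neq0$ be a measure on $M_k$. A measurable $L:M_k\to M_k$ is square integrable if $\int\|L(v)\|^2d\mu(v)<\infty$; put $\phi_L(\rho)=\int L(v)\rho L(v)^\dagger d\mu(v)$ and $\phi_L^*(\sigma)=\int L(v)^\dagger\sigma L(v)\,d\mu(v)$, and let $\lambda_L$ be the spectral radius of $\phi_L$. $L$ is irreducible if there are no $c>0$ and no orthogonal projection $p\ne 0,\mathrm{Id}$ with $\phi_L(p)\le c\,p$; it is stochastic if $\phi_L^*(\mathrm{Id})=\mathrm{Id}$. Let $\Phi_\mu$ be the set of square integrable, irreducible, stochastic $L$. Denote by $\rho_L$ the matrix with $\rho_L>0$, $\mathrm{tr}\,\rho_L=1$, $\phi_L(\rho_L)=\lambda_L\rho_L$, and by $\sigma_L$ the matrix with $\sigma_L>0$, $\mathrm{tr}(\sigma_L\rho_L)=1$, $\phi_L^*(\sigma_L)=\lambda_L\sigma_L$. For $L\in\Phi_\mu$ put $r_L(v)=\mathrm{tr}(L(v)\rho_LL(v)^\dagger)$,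 $P_L(v,w)=\mathrm{tr}(L(w)L(v)\rho_LL(v)^\dagger L(w)^\dagger)/r_L(v)$ and $$h_\mu(L)=-\int_{M_k\times M_k} r_L(v)\,P_L(v,w)\log P_L(v,w)\,d\mu(v)\,d\mu(w)$$ (with $0\log 0=0$, and the integrand read as $0$ where $r_L(v)=0$); $L$ has finite entropy if this integrand is integrable. Let $H:M_k\to M_k$ be square integrable and irreducible, with $H(v)\ne0$ for $\mu$-a.e. $v$. Put $U_H(v)=\log\mathrm{tr}(\sigma_HH(v)\rho_HH(v)^\dagger)$ and $q(v)=\lambda_H^{-1}\mathrm{tr}(\sigma_HH(v)\rho_HH(v)^\dagger)$. For $L\in\Phi_\mu$ of finite entropy put $F_H(L)=h_\mu(L)+\int U_H\,r_L\,d\mu\in[-\infty,\infty]$ (the integral being positive part minus negative part, with $\infty-\infty=-\infty$), and let the pressure $P(H)$ be the supremum of $F_H(L)$ over the $L\in\Phi_\mu$ of finite entropy. Such an $L$ (or $\phi_L$) is a Gibbs channel for $H$ if $F_H(L)=P(H)$. Then: 1. $\lambda_H>0$; the matrices $\rho_H$, $\sigma_H$, and $\rho_L$ for every $L\in\Phi_\mu$,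 exist and are unique. 2. $P(H)=\log\lambda_H$. 3. An $L\in\Phi_\mu$ of finite entropy is a Gibbs channel for $H$ if and only if, for $\mu$-a.e. $v$ with $r_L(v)\ne0$, one has $P_L(v,w)=q(w)$ for $\mu$-a.e. $w$. 4. Let $P$ be the cyclic shift $P=\sum_i|i\rangle\langle i+1|$ (indices mod $k$) and $Q=\mathrm{diag}(1,\dots,1,-1)$. There is an open set $O\subset M_k$ such that the map $L$ with $L(v)=\sqrt{q(v)}\,Q$ for $v\in O$ and $L(v)=\sqrt{q(v)}\,P$ for $v\notin O$ belongs to $\Phi_\mu$ and satisfies the identity $P_L(v,w)=q(w)$ in the sense of item 3. This $L$ is a Gibbs channel for $H$ if and only if $U_He^{U_H}$ is $\mu$-integrable (equivalently, this $L$ has finite entropy). -/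

import Mathlib

open MeasureTheory Matrix
open scoped ENNReal ComplexOrder

noncomputable section

namespace QChannel

/-- The space `M_k` of complex `k × k` matrices, with its usual topology. -/
abbrev Mat (k : ℕ) : Type := Matrix (Fin k) (Fin k) ℂ

/-- `M_k` carries its Borel σ-algebra. -/
instance matMeasurableSpace (k : ℕ) : MeasurableSpace (Mat k) := borel (Mat k)

instance matBorelSpace (k : ℕ) : BorelSpace (Mat k) := ⟨rfl⟩

variable {k : ℕ}

/-- The Hilbert–Schmidt norm `‖A‖ = √ tr (A A†)`. -/
def hsNorm (A : Mat k) : ℝ := Real.sqrt (A * Aᴴ).trace.re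

/-- `L` is measurable and `∫ ‖L(v)‖² dμ(v) < ∞`. -/
def SquareIntegrable (μ : Measure (Mat k)) (L : Mat k → Mat k) : Prop :=
  Measurable L ∧ Integrable (fun v => hsNorm (L v) ^ 2) μ

/-- The entrywise integral of a matrix-valued function. -/
def matIntegral (μ : Measure (Mat k)) (F : Mat k → Mat k) : Mat k :=
  Matrix.of fun i j => ∫ v, F v i j ∂μ

lemma hsNorm_sq (A : Mat k) : hsNorm A ^ 2 = ∑ i, ∑ j, ‖A i j‖ ^ 2 := by
  have h : (A * Aᴴ).trace.re = ∑ i, ∑ j, ‖A i j‖ ^ 2 := by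
    simp only [Matrix.trace, Matrix.diag_apply, Matrix.mul_apply, Matrix.conjTranspose_apply,
      Complex.re_sum]
    refine Finset.sum_congr rfl fun i _ => Finset.sum_congr rfl fun j _ => ?_
    rw [Complex.star_def, Complex.mul_conj, Complex.ofReal_re, Complex.normSq_eq_norm_sq]
  rw [hsNorm, h, Real.sq_sqrt]
  positivity

lemma norm_sq_le_hsNorm_sq (A : Mat k) (i j : Fin k) : ‖A i j‖ ^ 2 ≤ hsNorm A ^ 2 := by
  rw [hsNorm_sq]
  calc ‖A i j‖ ^ 2 ≤ ∑ j, ‖A i j‖ ^ 2 :=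
        Finset.single_le_sum (f := fun j => ‖A i j‖ ^ 2) (fun _ _ => by positivity)
          (Finset.mem_univ j)
    _ ≤ ∑ i, ∑ j, ‖A i j‖ ^ 2 :=
        Finset.single_le_sum (f := fun i => ∑ j, ‖A i j‖ ^ 2) (fun _ _ => by positivity)
          (Finset.mem_univ i)

lemma hsNorm_conjTranspose_sq (A : Mat k) : hsNorm Aᴴ ^ 2 = hsNorm A ^ 2 := by
  rw [hsNorm_sq, hsNorm_sq, Finset.sum_comm]
  simp [Matrix.conjTranspose_apply]

lemma SquareIntegrable.conjTranspose {μ : Measure (Mat k)} {L : Mat k → Mat k}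
    (h : SquareIntegrable μ L) : SquareIntegrable μ (fun v => (L v)ᴴ) := by
  refine ⟨(continuous_id.matrix_conjTranspose.measurable).comp h.1, ?_⟩
  simpa only [hsNorm_conjTranspose_sq] using h.2

lemma SquareIntegrable.entry {μ : Measure (Mat k)} {L : Mat k → Mat k}
    (h : SquareIntegrable μ L) (ρ : Mat k) (i j : Fin k) :
    Integrable (fun v => (L v * ρ * (L v)ᴴ) i j) μ := by
  have hm : ∀ a b, Measurable fun v => L v a b := fun a b =>
    ((continuous_id.matrix_elem a b).measurable).comp h.1
  have key : ∀ a b, Integrable (fun v => L v i a * ρ a b * star (L v j b)) μ := by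
    intro a b
    have hb : Integrable (fun v => L v i a * star (L v j b)) μ := by
      refine h.2.mono' ((hm i a).mul (Complex.continuous_conj.measurable.comp
        (hm j b))).aestronglyMeasurable (Filter.Eventually.of_forall fun v => ?_)
      rw [norm_mul, norm_star]
      nlinarith [norm_sq_le_hsNorm_sq (L v) i a, norm_sq_le_hsNorm_sq (L v) j b,
        sq_nonneg (‖L v i a‖ - ‖L v j b‖)]
    refine (hb.mul_const (ρ a b)).congr (Filter.Eventually.of_forall fun v => ?_)
    simp only; ring
  have : (fun v => (L v * ρ * (L v)ᴴ) i j)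
      = fun v => ∑ b, ∑ a, L v i a * ρ a b * star (L v j b) := by
    funext v
    simp only [Matrix.mul_apply, Matrix.conjTranspose_apply, Finset.sum_mul]
  rw [this]
  exact integrable_finsetSum _ fun b _ => integrable_finsetSum _ fun a _ => key a b

open Classical in
/-- The linear map `φ_L(ρ) = ∫ L(v) ρ L(v)† dμ(v)` on `M_k`, for square integrable `L`
(the value `0` for other `L` is never used). -/
def channel (μ : Measure (Mat k)) (L : Mat k → Mat k) : Module.End ℂ (Mat k) :=
  if h : SquareIntegrable μ L then
    { toFun := fun ρ => matIntegral μ fun v => L v * ρ * (L v)ᴴ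
      map_add' := fun ρ τ => by
        ext i j
        simp only [matIntegral, Matrix.of_apply, Matrix.add_apply]
        rw [← integral_add (h.entry ρ i j) (h.entry τ i j)]
        simp only [Matrix.mul_add, Matrix.add_mul, Matrix.add_apply]
      map_smul' := fun c ρ => by
        ext i j
        simp only [matIntegral, Matrix.of_apply, Matrix.smul_apply, Matrix.mul_smul,
          Matrix.smul_mul, RingHom.id_apply, integral_smul] }
  else 0

lemma channel_apply {μ : Measure (Mat k)} {L : Mat k → Mat k} (h : SquareIntegrable μ L)
    (ρ : Mat k) : channel μ L ρ = matIntegral μ fun v => L v * ρ * (L v)ᴴ := by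
  simp [channel, h]

/-- The dual map `φ_L^*(σ) = ∫ L(v)† σ L(v) dμ(v)`. -/
def dualChannel (μ : Measure (Mat k)) (L : Mat k → Mat k) : Module.End ℂ (Mat k) :=
  channel μ fun v => (L v)ᴴ

lemma dualChannel_apply {μ : Measure (Mat k)} {L : Mat k → Mat k} (h : SquareIntegrable μ L)
    (σ : Mat k) : dualChannel μ L σ = matIntegral μ fun v => (L v)ᴴ * σ * L v := by
  simp [dualChannel, channel_apply h.conjTranspose]

lemma trace_matIntegral_mul {μ : Measure (Mat k)} {F : Mat k → Mat k}
    (hF : ∀ i j, Integrable (fun v => F v i j) μ) (B : Mat k) :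
    (matIntegral μ F * B).trace = ∫ v, (F v * B).trace ∂μ := by
  simp only [matIntegral, Matrix.trace, Matrix.diag_apply, Matrix.mul_apply, Matrix.of_apply]
  rw [integral_finsetSum _ fun i _ => integrable_finsetSum _ fun j _ =>
    (hF i j).mul_const (B j i)]
  refine Finset.sum_congr rfl fun i _ => ?_
  rw [integral_finsetSum _ fun j _ => (hF i j).mul_const (B j i)]
  exact Finset.sum_congr rfl fun j _ => (integral_mul_const _ _).symm

/-- `φ_L^*` is the dual of `φ_L` for the Hilbert–Schmidt product `⟨A, B⟩ = tr (A B†)`. -/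
lemma trace_channel_mul {μ : Measure (Mat k)} {L : Mat k → Mat k} (h : SquareIntegrable μ L)
    (X Y : Mat k) :
    (channel μ L X * Yᴴ).trace = (X * (dualChannel μ L Y)ᴴ).trace := by
  have hd : (dualChannel μ L Y)ᴴ = dualChannel μ L Yᴴ := by
    rw [dualChannel_apply h, dualChannel_apply h]
    ext i j
    simp only [matIntegral, Matrix.conjTranspose_apply, Matrix.of_apply, Complex.star_def]
    rw [← integral_conj]
    congr 1
    funext v
    change ((L v)ᴴ * Y * L v)ᴴ i j = _
    simp only [Matrix.conjTranspose_mul, Matrix.conjTranspose_conjTranspose, Matrix.mul_assoc]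
  rw [hd, Matrix.trace_mul_comm X, dualChannel_apply h, channel_apply h,
    trace_matIntegral_mul (h.entry X), trace_matIntegral_mul]
  · congr 1
    funext v
    rw [Matrix.mul_assoc, Matrix.mul_assoc, Matrix.trace_mul_comm (L v)]
    rw [Matrix.trace_mul_comm ((L v)ᴴ * Yᴴ * L v)]
    simp only [Matrix.mul_assoc]
  · simpa using h.conjTranspose.entry Yᴴ

/-- A (positive) map `φ` on `M_k` is irreducible: there are no `c > 0` and no orthogonal
projection `p` onto a nontrivial proper subspace of `ℂ^k` with `φ(p) ≤ c p`. -/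
def IsIrreducible (φ : Module.End ℂ (Mat k)) : Prop :=
  ¬ ∃ (c : ℝ) (p : Mat k), 0 < c ∧ IsStarProjection p ∧ p ≠ 0 ∧ p ≠ 1 ∧
    ((c : ℂ) • p - φ p).PosSemidef

/-- `λ_L`, the spectral radius of `φ_L`. -/
def specRadius (μ : Measure (Mat k)) (L : Mat k → Mat k) : ℝ :=
  (spectralRadius ℂ (channel μ L)).toReal

/-- `ρ > 0`, `tr ρ = 1` and `φ_L(ρ) = λ_L ρ`. -/
def IsEigenDensity (μ : Measure (Mat k)) (L : Mat k → Mat k) (ρ : Mat k) : Prop :=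
  ρ.PosDef ∧ ρ.trace = 1 ∧ channel μ L ρ = (specRadius μ L : ℂ) • ρ

/-- `ρ_L`: the matrix characterized by `IsEigenDensity` (meaningful when there is exactly one). -/
def rhoOf (μ : Measure (Mat k)) (L : Mat k → Mat k) : Mat k :=
  Classical.epsilon (IsEigenDensity μ L)

/-- `σ > 0`, `tr (σ ρ_L) = 1` and `φ_L^*(σ) = λ_L σ`. -/
def IsDualEigenmatrix (μ : Measure (Mat k)) (L : Mat k → Mat k) (σ : Mat k) : Prop :=
  σ.PosDef ∧ (σ * rhoOf μ L).trace = 1 ∧ dualChannel μ L σ = (specRadius μ L : ℂ) • σ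

/-- `σ_L`: the matrix characterized by `IsDualEigenmatrix` (meaningful when there is exactly
one). -/
def sigmaOf (μ : Measure (Mat k)) (L : Mat k → Mat k) : Mat k :=
  Classical.epsilon (IsDualEigenmatrix μ L)

/-- `Φ_μ`: the square integrable, irreducible and stochastic (`φ_L^*(Id) = Id`) maps `L`. -/
def stochasticIrreducible (μ : Measure (Mat k)) : Set (Mat k → Mat k) :=
  {L | SquareIntegrable μ L ∧ IsIrreducible (channel μ L) ∧ dualChannel μ L 1 = 1}

/-- `tr (L(v) ρ_L L(v)†)`. -/
def stateDensity (μ : Measure (Mat k)) (L : Mat k → Mat k) (v : Mat k) : ℝ :=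
  (L v * rhoOf μ L * (L v)ᴴ).trace.re

/-- `P_L(v,w) = tr (L(w) L(v) ρ_L L(v)† L(w)†) / tr (L(v) ρ_L L(v)†)`. -/
def transition (μ : Measure (Mat k)) (L : Mat k → Mat k) (v w : Mat k) : ℝ :=
  (L w * L v * rhoOf μ L * (L v)ᴴ * (L w)ᴴ).trace.re / stateDensity μ L v

/-- The integrand `tr (L(v) ρ_L L(v)†) P_L(v,w) log P_L(v,w)` of the entropy. -/
def entropyIntegrand (μ : Measure (Mat k)) (L : Mat k → Mat k) (x : Mat k × Mat k) : ℝ :=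
  stateDensity μ L x.1 * (transition μ L x.1 x.2 * Real.log (transition μ L x.1 x.2))

/-- The entropy of `L` is finite. -/
def HasFiniteEntropy (μ : Measure (Mat k)) (L : Mat k → Mat k) : Prop :=
  Integrable (entropyIntegrand μ L) (μ.prod μ)

/-- The entropy `h_μ(L)`. -/
def entropy (μ : Measure (Mat k)) (L : Mat k → Mat k) : ℝ :=
  - ∫ x, entropyIntegrand μ L x ∂(μ.prod μ)

/-- The integral `∫ f⁺ dμ - ∫ f⁻ dμ` in `[-∞, ∞]` (with `∞ - ∞ = -∞`). -/
def extIntegral (μ : Measure (Mat k)) (f : Mat k → ℝ) : EReal :=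
  ((∫⁻ v, ENNReal.ofReal (f v) ∂μ : ℝ≥0∞) : EReal)
    - ((∫⁻ v, ENNReal.ofReal (-f v) ∂μ : ℝ≥0∞) : EReal)

/-- `tr (σ_H H(v) ρ_H H(v)†)`. -/
def hamWeight (μ : Measure (Mat k)) (H : Mat k → Mat k) (v : Mat k) : ℝ :=
  (sigmaOf μ H * H v * rhoOf μ H * (H v)ᴴ).trace.re

/-- The potential `U_H(v) = log tr (σ_H H(v) ρ_H H(v)†)`. -/
def potential (μ : Measure (Mat k)) (H : Mat k → Mat k) (v : Mat k) : ℝ :=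
  Real.log (hamWeight μ H v)

/-- `h_μ(L) + ∫ U_H(v) tr (L(v) ρ_L L(v)†) dμ(v)`. -/
def freeEnergy (μ : Measure (Mat k)) (H L : Mat k → Mat k) : EReal :=
  (entropy μ L : EReal) + extIntegral μ fun v => potential μ H v * stateDensity μ L v

/-- The pressure `P(H)`: the supremum, over the `L ∈ Φ_μ` of finite entropy, of
`h_μ(L) + ∫ U_H(v) tr (L(v) ρ_L L(v)†) dμ(v)`. -/
def pressure (μ : Measure (Mat k)) (H : Mat k → Mat k) : EReal :=
  ⨆ L ∈ {L | L ∈ stochasticIrreducible μ ∧ HasFiniteEntropy μ L}, freeEnergy μ H L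

/-- `φ_L` is a Gibbs channel for `H`: it attains the supremum defining the pressure. -/
def IsGibbsChannel (μ : Measure (Mat k)) (H L : Mat k → Mat k) : Prop :=
  L ∈ stochasticIrreducible μ ∧ HasFiniteEntropy μ L ∧ freeEnergy μ H L = pressure μ H

/-- `P_L(v,w) = tr (σ_H H(w) ρ_H H(w)†) / λ_H`, almost everywhere with respect to
`tr (L(v) ρ_L L(v)†) dμ(v)` and `dμ(w)`. -/
def GibbsIdentity (μ : Measure (Mat k)) (H L : Mat k → Mat k) : Prop :=
  ∀ᵐ v ∂μ, stateDensity μ L v ≠ 0 →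
    ∀ᵐ w ∂μ, transition μ L v w = hamWeight μ H w / specRadius μ H

/-- The cyclic shift `P = ∑ i, |i⟩⟨i+1|`. -/
def shiftMatrix (k : ℕ) : Mat k :=
  Matrix.of fun i j => if j = finRotate k i then 1 else 0

/-- The sign flip `Q = diag(1, …, 1, -1)`. -/
def flipMatrix (k : ℕ) : Mat k :=
  Matrix.diagonal fun i => if (i : ℕ) + 1 = k then -1 else 1

open Classical in
/-- `√(tr (σ_H H(v) ρ_H H(v)†) / λ_H)` times `Q` for `v ∈ O`, and times `P` for `v ∉ O`. -/
def gibbsMap (μ : Measure (Mat k)) (H : Mat k → Mat k) (O : Set (Mat k)) (v : Mat k) : Mat k :=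
  ((Real.sqrt (hamWeight μ H v / specRadius μ H) : ℝ) : ℂ) •
    (if v ∈ O then flipMatrix k else shiftMatrix k)

end QChannel

end

open QChannel

/-!
The existence of the eigenmatrices is Perron–Frobenius theory for positive maps on the cone of
positive semidefinite matrices. Irreducibility means that `1 + φ` strictly enlarges the support of
every singular nonzero element of the cone, so a power of `1 + φ` sends it to the interior
(`IsPositiveMap.exists_pow_posDef`). The Collatz–Wielandt maximum is then attained at an eigenmatrix
(`IsPositiveMap.exists_posDef_eigen`); a positive definite eigenmatrix is unique up to scaling and
its eigenvalue is the spectral radius. All of this passes to the dual map, and pairing the two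
eigenmatrices shows that the eigenvalues agree (`perronFrobenius`).

For stochastic irreducible `L`, the functions `r_L` and `P_L` are the densities of a stationary
Markov chain (`isMarkovDensity_of_stochastic`), and `q = tr (σ_H H ρ_H H†) / λ_H` is a probability
density with `U_H = log λ_H + log q` almost everywhere. Stationarity turns `∫ U_H r_L` into a double
integral, and the free energy becomes
`log λ_H - ∫∫ r_L(v) q(w) klFun (P_L(v,w) / q(w))`, with `klFun x = x log x + 1 - x`
(`IsHamiltonian.freeEnergy_eq_sub_relEntropy`). Since `klFun` is nonnegative on `[0, ∞)` and
vanishes only at `1`, the free energy is at most `log λ_H`, with equality exactly for `P_L = q`. If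
`U_H r_L` is not integrable, only its negative part can be at fault, and the free energy is `-∞`.

For a probability density `g` and an open set `O`, the map `√g Q` on `O` and `√g P` off `O` has
channel `a Q X Q† + b P X P†`, where `a` and `b` are the masses of `O` and its complement under `g`.
The matrices `P` and `Q` have no common nontrivial invariant subspace, so the channel is irreducible
if `a, b > 0`; it is unital, so the invariant state is `1 / k` and the outcomes are independent draws
from `g`. A set `O` charged together with its complement exists for `k ≥ 2`, since for `μ`
concentrated at one point an eigenvector of `H` would contradict irreducibility
(`IsHamiltonian.not_ae_const`). With `g = q` this is the Gibbs map. Its entropy may be infinite; then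
the supremum is still approached by taking for `g` the density `q` conditioned to
`{1/(n+1) ≤ q ≤ n+1}`, with free energy `log λ_H + log Z_n`, where `Z_n → 1` is the mass of that set
(`IsHamiltonian.freeEnergy_truncated`, `IsHamiltonian.pressure_eq`).
-/

/-! ### Order properties of complex matrices -/

namespace Matrix

variable {n : Type*} [Fintype n] [DecidableEq n]

lemma PosSemidef.exists_eq_conjTranspose_mul_self {A : Matrix n n ℂ} (hA : A.PosSemidef) :
    ∃ B : Matrix n n ℂ, A = Bᴴ * B := by
  open scoped MatrixOrder Matrix.Norms.L2Operator in
  exact CStarAlgebra.nonneg_iff_eq_star_mul_self.mp hA.nonneg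

lemma IsHermitian.exists_unitary_diagonal {A : Matrix n n ℂ} (hA : A.IsHermitian) :
    ∃ (U : Matrix n n ℂ) (d : n → ℝ), U * Uᴴ = 1 ∧ Uᴴ * U = 1 ∧
      A = U * diagonal (fun i => (d i : ℂ)) * Uᴴ := by
  refine ⟨hA.eigenvectorUnitary, hA.eigenvalues, ?_, ?_, ?_⟩
  · exact Unitary.coe_mul_star_self hA.eigenvectorUnitary
  · exact Unitary.coe_star_mul_self hA.eigenvectorUnitary
  · conv_lhs => rw [hA.spectral_theorem]
    simp only [Unitary.conjStarAlgAut_apply]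
    rfl

lemma IsHermitian.exists_posSemidef_smul_one_sub {A : Matrix n n ℂ} (hA : A.IsHermitian) :
    ∃ c : ℝ, 0 < c ∧ ((c : ℂ) • (1 : Matrix n n ℂ) - A).PosSemidef := by
  obtain ⟨U, d, hU, -, hd⟩ := hA.exists_unitary_diagonal
  refine ⟨1 + ∑ i, |d i|, by positivity, ?_⟩
  have h1 : (((1 + ∑ i, |d i| : ℝ) : ℂ) • (1 : Matrix n n ℂ) - A)
      = U * diagonal (fun i => (((1 + ∑ i, |d i|) - d i : ℝ) : ℂ)) * Uᴴ := by
    have : diagonal (fun i => (((1 + ∑ i, |d i|) - d i : ℝ) : ℂ))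
        = ((1 + ∑ i, |d i| : ℝ) : ℂ) • (1 : Matrix n n ℂ) - diagonal (fun i => (d i : ℂ)) := by
      ext i j
      by_cases h : i = j
      · subst h; simp
      · simp [h]
    rw [this, Matrix.mul_sub, Matrix.sub_mul, ← hd, Matrix.mul_smul, Matrix.smul_mul,
      Matrix.mul_one, hU]
  rw [h1]
  refine PosSemidef.mul_mul_conjTranspose_same (PosSemidef.diagonal fun i => ?_) U
  have h2 : |d i| ≤ ∑ i, |d i| :=
    Finset.single_le_sum (f := fun i => |d i|) (fun _ _ => abs_nonneg _) (Finset.mem_univ i)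
  have h3 := le_abs_self (d i)
  simp only [Pi.zero_apply]
  exact_mod_cast (by linarith : (0 : ℝ) ≤ (1 + ∑ i, |d i|) - d i)

/-- A positive definite matrix is an order unit of the Hermitian matrices. -/
lemma PosDef.exists_posSemidef_smul_sub {ρ Y : Matrix n n ℂ} (hρ : ρ.PosDef)
    (hY : Y.IsHermitian) : ∃ c : ℝ, 0 < c ∧ ((c : ℂ) • ρ - Y).PosSemidef := by
  obtain ⟨B, rfl⟩ := hρ.posSemidef.exists_eq_conjTranspose_mul_self
  have hB : IsUnit B.det := by
    have := (Matrix.isUnit_iff_isUnit_det _).mp hρ.isUnit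
    rw [Matrix.det_mul] at this
    exact isUnit_of_mul_isUnit_right this
  have hZ : (B⁻¹ᴴ * Y * B⁻¹).IsHermitian := isHermitian_conjTranspose_mul_mul B⁻¹ hY
  obtain ⟨c, hc, h⟩ := hZ.exists_posSemidef_smul_one_sub
  refine ⟨c, hc, ?_⟩
  have h' := h.conjTranspose_mul_mul_same B
  have e : Bᴴ * ((c : ℂ) • (1 : Matrix n n ℂ) - B⁻¹ᴴ * Y * B⁻¹) * B
      = (c : ℂ) • (Bᴴ * B) - Y := by
    have e1 : Bᴴ * (B⁻¹ᴴ * Y * B⁻¹) * B = Y := by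
      have : Bᴴ * B⁻¹ᴴ = 1 := by
        rw [← conjTranspose_mul, Matrix.nonsing_inv_mul _ hB, conjTranspose_one]
      calc Bᴴ * (B⁻¹ᴴ * Y * B⁻¹) * B = (Bᴴ * B⁻¹ᴴ) * Y * (B⁻¹ * B) := by
            simp only [Matrix.mul_assoc]
        _ = Y := by rw [this, Matrix.nonsing_inv_mul _ hB, Matrix.one_mul, Matrix.mul_one]
    rw [Matrix.mul_sub, Matrix.sub_mul, e1, Matrix.mul_smul, Matrix.smul_mul, Matrix.mul_one]
  rwa [e] at h'

lemma trace_mul_nonneg {A B : Matrix n n ℂ} (hA : A.PosSemidef) (hB : B.PosSemidef) :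
    0 ≤ (A * B).trace := by
  obtain ⟨C, rfl⟩ := hA.exists_eq_conjTranspose_mul_self
  rw [Matrix.mul_assoc, Matrix.trace_mul_comm, ]
  exact (hB.mul_mul_conjTranspose_same C).trace_nonneg

/-- Two positive semidefinite matrices with `tr (A B) = 0` have product zero. -/
lemma PosSemidef.mul_eq_zero_of_trace_mul_eq_zero {A B : Matrix n n ℂ} (hA : A.PosSemidef)
    (hB : B.PosSemidef) (h : (A * B).trace = 0) : A * B = 0 := by
  obtain ⟨C, rfl⟩ := hA.exists_eq_conjTranspose_mul_self
  obtain ⟨D, rfl⟩ := hB.exists_eq_conjTranspose_mul_self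
  have h1 : ((D * Cᴴ)ᴴ * (D * Cᴴ)).trace = 0 := by
    rw [conjTranspose_mul, conjTranspose_conjTranspose, ← h]
    rw [← Matrix.mul_assoc, Matrix.trace_mul_comm]
    simp only [Matrix.mul_assoc]
  have h2 : D * Cᴴ = 0 := trace_conjTranspose_mul_self_eq_zero_iff.mp h1
  have h3 : C * Dᴴ = 0 := by
    have := congrArg (fun M : Matrix n n ℂ => Mᴴ) h2
    simpa using this
  calc Cᴴ * C * (Dᴴ * D) = Cᴴ * (C * Dᴴ) * D := by simp only [Matrix.mul_assoc]
    _ = 0 := by rw [h3]; simp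

lemma PosDef.trace_mul_pos {σ A : Matrix n n ℂ} (hσ : σ.PosDef) (hA : A.PosSemidef)
    (h : A ≠ 0) : 0 < (σ * A).trace := by
  refine lt_of_le_of_ne (trace_mul_nonneg hσ.posSemidef hA) fun h0 => h ?_
  have h1 := hσ.posSemidef.mul_eq_zero_of_trace_mul_eq_zero hA h0.symm
  have := congrArg (σ⁻¹ * ·) h1
  simpa [← Matrix.mul_assoc,
    Matrix.nonsing_inv_mul _ ((Matrix.isUnit_iff_isUnit_det _).mp hσ.isUnit)] using this

omit [DecidableEq n] in
lemma PosSemidef.eq_zero_of_neg {A : Matrix n n ℂ}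
    (h : A.PosSemidef) (h' : (-A).PosSemidef) : A = 0 := by
  have h1 := h.trace_nonneg
  have h2 := h'.trace_nonneg
  rw [trace_neg, neg_nonneg] at h2
  exact h.trace_eq_zero_iff.mp (le_antisymm h2 h1)

omit [DecidableEq n] in
lemma posSemidef_of_isStarProjection {p : Matrix n n ℂ} (hp : IsStarProjection p) :
    p.PosSemidef := by
  have h : pᴴ * p = p := by
    rw [← star_eq_conjTranspose, hp.isSelfAdjoint.star_eq, hp.isIdempotentElem.eq]
  rw [← h]
  exact posSemidef_conjTranspose_mul_self p

/-- A positive semidefinite matrix that vanishes on the complement of `p` is at most a multiple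
of `p`. -/
lemma PosSemidef.exists_posSemidef_smul_sub {A p : Matrix n n ℂ} (hA : A.PosSemidef)
    (hp : IsStarProjection p) (h : A * (1 - p) = 0) :
    ∃ c : ℝ, 0 < c ∧ ((c : ℂ) • p - A).PosSemidef := by
  obtain ⟨c, hc, h1⟩ := hA.isHermitian.exists_posSemidef_smul_one_sub
  refine ⟨c, hc, ?_⟩
  have hpH : pᴴ = p := hp.isSelfAdjoint.star_eq
  have h2 : A * p = A := by rw [Matrix.mul_sub, Matrix.mul_one, sub_eq_zero] at h; exact h.symm
  have h3 : p * A = A := by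
    have := congrArg (fun M : Matrix n n ℂ => Mᴴ) h2
    simp only [conjTranspose_mul] at this
    rwa [hpH, hA.isHermitian.eq] at this
  have h4 := h1.conjTranspose_mul_mul_same p
  rwa [hpH, Matrix.mul_sub, Matrix.sub_mul, h3, h2, Matrix.mul_smul, Matrix.smul_mul,
    Matrix.mul_one, hp.isIdempotentElem.eq] at h4

/-- The support projection `p` of a positive semidefinite matrix `A`: it satisfies `m p ≤ A` for
some `m > 0`, and `A` vanishes on the complement of `p`. -/
lemma PosSemidef.exists_support {A : Matrix n n ℂ} (hA : A.PosSemidef) :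
    ∃ p : Matrix n n ℂ, IsStarProjection p ∧ A * (1 - p) = 0 ∧
      ∃ m : ℝ, 0 < m ∧ (A - (m : ℂ) • p).PosSemidef := by
  obtain ⟨U, d, -, hU', hd⟩ := hA.isHermitian.exists_unitary_diagonal
  have hd0 : ∀ i, 0 ≤ d i := by
    have h := hA.conjTranspose_mul_mul_same U
    have e : Uᴴ * A * U = diagonal (fun i => (d i : ℂ)) := by
      rw [hd]
      calc Uᴴ * (U * diagonal (fun i => (d i : ℂ)) * Uᴴ) * U
          = (Uᴴ * U) * diagonal (fun i => (d i : ℂ)) * (Uᴴ * U) := by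
            simp only [Matrix.mul_assoc]
        _ = _ := by rw [hU', Matrix.one_mul, Matrix.mul_one]
    rw [e, posSemidef_diagonal_iff] at h
    exact fun i => by exact_mod_cast h i
  have key : ∀ X Y : Matrix n n ℂ, U * X * Uᴴ * (U * Y * Uᴴ) = U * (X * Y) * Uᴴ := by
    intro X Y
    calc U * X * Uᴴ * (U * Y * Uᴴ) = U * X * (Uᴴ * U) * Y * Uᴴ := by simp only [Matrix.mul_assoc]
      _ = _ := by rw [hU', Matrix.mul_one]; simp only [Matrix.mul_assoc]
  set e : n → ℂ := fun i => if d i = 0 then 0 else 1 with he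
  obtain ⟨m, hm, hmd⟩ : ∃ m : ℝ, 0 < m ∧ ∀ i, d i ≠ 0 → m ≤ d i := by
    by_cases hs : (Finset.univ.filter fun i => d i ≠ 0).Nonempty
    · obtain ⟨j, hj, hmin⟩ := Finset.exists_min_image _ d hs
      refine ⟨d j, lt_of_le_of_ne (hd0 j) (Ne.symm (Finset.mem_filter.mp hj).2), fun i hi => ?_⟩
      exact hmin i (Finset.mem_filter.mpr ⟨Finset.mem_univ _, hi⟩)
    · refine ⟨1, one_pos, fun i hi => (hs ⟨i, ?_⟩).elim⟩
      exact Finset.mem_filter.mpr ⟨Finset.mem_univ _, hi⟩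
  refine ⟨U * diagonal e * Uᴴ, ⟨?_, ?_⟩, ?_, m, hm, ?_⟩
  · rw [IsIdempotentElem, key, diagonal_mul_diagonal]
    congr 3
    funext i
    by_cases h : d i = 0 <;> simp [he, h]
  · rw [IsSelfAdjoint, star_eq_conjTranspose]
    simp only [conjTranspose_mul, conjTranspose_conjTranspose, diagonal_conjTranspose,
      Matrix.mul_assoc]
    congr 3
    funext i
    by_cases h : d i = 0 <;> simp [he, h]
  · rw [Matrix.mul_sub, Matrix.mul_one, hd, key, diagonal_mul_diagonal, sub_eq_zero]
    congr 3
    funext i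
    by_cases h : d i = 0 <;> simp [he, h]
  · have e1 : A - (m : ℂ) • (U * diagonal e * Uᴴ)
        = U * diagonal (fun i => (d i : ℂ) - m * e i) * Uᴴ := by
      rw [hd, ← Matrix.smul_mul, ← Matrix.mul_smul, ← Matrix.sub_mul, ← Matrix.mul_sub,
        ← diagonal_smul, diagonal_sub]
      rfl
    rw [e1]
    refine PosSemidef.mul_mul_conjTranspose_same (PosSemidef.diagonal fun i => ?_) U
    by_cases h : d i = 0
    · simp [he, h]
    · have := hmd i h
      simpa [he, h] using this

omit [DecidableEq n] in
/-- The entries of a positive semidefinite matrix are bounded by its trace. -/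
lemma PosSemidef.norm_apply_le_trace {A : Matrix n n ℂ} (hA : A.PosSemidef) (i j : n) :
    ‖A i j‖ ≤ A.trace.re := by
  classical
  obtain ⟨B, rfl⟩ := hA.exists_eq_conjTranspose_mul_self
  have ht : (Bᴴ * B).trace.re = ∑ a, ∑ l, ‖B l a‖ ^ 2 := by
    simp only [Matrix.trace, Matrix.diag_apply, Matrix.mul_apply, Matrix.conjTranspose_apply,
      Complex.re_sum]
    refine Finset.sum_congr rfl fun a _ => Finset.sum_congr rfl fun l _ => ?_
    rw [Complex.star_def, mul_comm, Complex.mul_conj, Complex.ofReal_re,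
      Complex.normSq_eq_norm_sq]
  have hcol : ∀ a, ∑ l, ‖B l a‖ ^ 2 ≤ ∑ a, ∑ l, ‖B l a‖ ^ 2 := fun a =>
    Finset.single_le_sum (f := fun a => ∑ l, ‖B l a‖ ^ 2) (fun _ _ => by positivity)
      (Finset.mem_univ a)
  rw [ht, Matrix.mul_apply]
  calc ‖∑ l, Bᴴ i l * B l j‖ ≤ ∑ l, ‖Bᴴ i l * B l j‖ := norm_sum_le _ _
    _ ≤ ∑ l, (‖B l i‖ ^ 2 + ‖B l j‖ ^ 2) / 2 := by
        refine Finset.sum_le_sum fun l _ => ?_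
        rw [norm_mul, conjTranspose_apply, norm_star]
        nlinarith [sq_nonneg (‖B l i‖ - ‖B l j‖)]
    _ = ((∑ l, ‖B l i‖ ^ 2) + ∑ l, ‖B l j‖ ^ 2) / 2 := by
        rw [← Finset.sum_add_distrib, Finset.sum_div]
    _ ≤ _ := by linarith [hcol i, hcol j]

omit [DecidableEq n] in
lemma isClosed_setOf_posSemidef : IsClosed {A : Matrix n n ℂ | A.PosSemidef} := by
  simp only [posSemidef_iff_dotProduct_mulVec, Set.ofPred_and, Set.ofPred_forall]
  refine IsClosed.inter ?_ (isClosed_iInter fun x => ?_)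
  · exact isClosed_eq (continuous_id.matrix_conjTranspose) continuous_id
  · exact isClosed_Ici.preimage (f := fun A : Matrix n n ℂ => star x ⬝ᵥ A *ᵥ x)
      (Continuous.dotProduct continuous_const (continuous_id.matrix_mulVec continuous_const))

end Matrix

/-! ### Perron–Frobenius theory of irreducible positive maps -/

namespace QChannel

variable {k : ℕ}

/-- A linear map on matrices is positive if it preserves positive semidefiniteness. -/
def IsPositiveMap (φ : Module.End ℂ (Mat k)) : Prop :=
  ∀ A : Mat k, A.PosSemidef → (φ A).PosSemidef

lemma _root_.Matrix.PosSemidef.real_smul {A : Mat k} (hA : A.PosSemidef) {c : ℝ} (hc : 0 ≤ c) :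
    ((c : ℂ) • A).PosSemidef :=
  hA.smul (by exact_mod_cast hc)

lemma IsPositiveMap.one_add_pow {φ : Module.End ℂ (Mat k)} (hφ : IsPositiveMap φ) (N : ℕ) :
    IsPositiveMap ((1 + φ) ^ N) := by
  induction N with
  | zero => intro A hA; simpa using hA
  | succ N ih =>
    intro A hA
    rw [pow_succ']
    exact (ih A hA).add (hφ _ (ih A hA))

lemma IsPositiveMap.pow {φ : Module.End ℂ (Mat k)} (hφ : IsPositiveMap φ) (N : ℕ) :
    IsPositiveMap (φ ^ N) := by
  induction N with
  | zero => intro A hA; simpa using hA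
  | succ N ih =>
    intro A hA
    rw [pow_succ']
    exact hφ _ (ih A hA)

lemma pow_apply_of_eigen {φ : Module.End ℂ (Mat k)} {X : Mat k} {r : ℂ} (h : φ X = r • X)
    (N : ℕ) : (φ ^ N) X = r ^ N • X := by
  induction N with
  | zero => simp
  | succ N ih => rw [pow_succ', Module.End.mul_apply, ih, map_smul, h, smul_smul, pow_succ]

lemma apply_one_add_pow_comm (φ : Module.End ℂ (Mat k)) (N : ℕ) (X : Mat k) :
    φ (((1 + φ) ^ N) X) = ((1 + φ) ^ N) (φ X) := by
  have h : Commute φ ((1 + φ) ^ N) := ((Commute.one_right φ).add_right (Commute.refl φ)).pow_right N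
  exact congrArg (fun f : Module.End ℂ (Mat k) => f X) h.eq

lemma posDef_of_posSemidef_sub_smul_one {X : Mat k} {m : ℝ} (hm : 0 < m)
    (h : (X - (m : ℂ) • (1 : Mat k)).PosSemidef) : X.PosDef := by
  have h1 : ((m : ℂ) • (1 : Mat k)).PosDef := PosDef.one.smul (by exact_mod_cast hm)
  simpa using h1.add_posSemidef h

/-- An irreducible positive map leaves no face of the cone invariant, so that applying `1 + φ`
strictly enlarges the support of a singular matrix; after finitely many steps the support is
everything. -/
lemma IsPositiveMap.exists_pow_posDef {φ : Module.End ℂ (Mat k)} (hφ : IsPositiveMap φ)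
    (hirr : IsIrreducible φ) {X : Mat k} (hX : X.PosSemidef) (hX0 : X ≠ 0) :
    ∃ N : ℕ, (((1 + φ) ^ N) X).PosDef := by
  induction hd : Module.finrank ℂ (LinearMap.ker X.mulVecLin) using Nat.strong_induction_on
    generalizing X with
  | _ d ih =>
  by_cases hpd : X.PosDef
  · exact ⟨0, by simpa using hpd⟩
  have hφX := hφ X hX
  have hX' : (X + φ X).PosSemidef := hX.add hφX
  have hle : LinearMap.ker (X + φ X).mulVecLin ≤ LinearMap.ker X.mulVecLin := by
    intro x hx
    rw [LinearMap.mem_ker, mulVecLin_apply] at hx ⊢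
    rw [← hX.dotProduct_mulVec_zero_iff]
    have h1 : star x ⬝ᵥ X *ᵥ x + star x ⬝ᵥ φ X *ᵥ x = 0 := by
      rw [← dotProduct_add, ← add_mulVec, hx, dotProduct_zero]
    have h2 := hX.dotProduct_mulVec_nonneg x
    have h3 := hφX.dotProduct_mulVec_nonneg x
    exact ((add_eq_zero_iff_of_nonneg h2 h3).mp h1).1
  have hX'0 : X + φ X ≠ 0 := by
    intro h
    refine hX0 (PosSemidef.eq_zero_of_neg hX ?_)
    rw [neg_eq_of_add_eq_zero_right h]
    exact hφX
  rcases hle.lt_or_eq with hlt | heq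
  · obtain ⟨N, hN⟩ := ih _ (hd ▸ Submodule.finrank_lt_finrank_of_lt hlt) hX' hX'0 rfl
    refine ⟨N + 1, ?_⟩
    rw [pow_succ]
    exact hN
  -- the support has not grown: the support projection `p` of `X` satisfies `φ p ≤ (c / m) p`
  · exfalso
    obtain ⟨p, hp, hXp, m, hm, hmp⟩ := hX.exists_support
    have h1 : φ X * (1 - p) = 0 := by
      have h2 : (X + φ X) * (1 - p) = 0 := by
        ext i j
        have hj : (1 - p).col j ∈ LinearMap.ker (X + φ X).mulVecLin := by
          rw [heq, LinearMap.mem_ker, mulVecLin_apply]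
          funext i
          exact congrFun (congrFun hXp i) j
        exact congrFun hj i
      rwa [Matrix.add_mul, hXp, zero_add] at h2
    obtain ⟨c, hc, hcp⟩ := hφX.exists_posSemidef_smul_sub hp h1
    refine hirr ⟨m⁻¹ * c, p, by positivity, hp, ?_, ?_, ?_⟩
    · rintro rfl
      simp at hXp
      exact hX0 hXp
    · rintro rfl
      exact hpd (posDef_of_posSemidef_sub_smul_one hm hmp)
    · have h2 := (hφ _ hmp).add hcp
      have h3 := h2.real_smul (inv_nonneg.mpr hm.le)
      have hm' : (m : ℂ) ≠ 0 := by exact_mod_cast hm.ne'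
      convert h3 using 1
      rw [map_sub, map_smul]
      push_cast
      rw [show φ X - (m : ℂ) • φ p + ((c : ℂ) • p - φ X) = (c : ℂ) • p - (m : ℂ) • φ p by abel,
        smul_sub, smul_smul, smul_smul, inv_mul_cancel₀ hm', one_smul]

lemma isCompact_density : IsCompact {X : Mat k | X.PosSemidef ∧ X.trace = 1} := by
  have hc : IsCompact (Set.univ.pi fun _ : Fin k => Set.univ.pi fun _ : Fin k =>
      Metric.closedBall (0 : ℂ) 1) :=
    isCompact_univ_pi fun _ => isCompact_univ_pi fun _ => isCompact_closedBall _ _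
  refine IsCompact.of_isClosed_subset (X := Mat k) hc ?_ ?_
  · exact isClosed_setOf_posSemidef.inter
      (isClosed_eq (continuous_id.matrix_trace) continuous_const)
  · rintro X ⟨hX, ht⟩ i - j -
    have := hX.norm_apply_le_trace i j
    rw [ht] at this
    simpa using this

lemma continuous_end (φ : Module.End ℂ (Mat k)) : Continuous φ :=
  LinearMap.continuous_of_finiteDimensional φ

/-- Collatz–Wielandt: the largest `r` such that `r X ≤ φ(X)` for some density matrix `X` is an
eigenvalue of an irreducible positive map, with a positive definite eigenmatrix. -/
lemma IsPositiveMap.exists_posDef_eigen (hk : 0 < k) {φ : Module.End ℂ (Mat k)}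
    (hφ : IsPositiveMap φ) (hirr : IsIrreducible φ) :
    ∃ r : ℝ, 0 ≤ r ∧ ∃ ρ : Mat k, ρ.PosDef ∧ φ ρ = (r : ℂ) • ρ := by
  have : Nonempty (Fin k) := ⟨⟨0, hk⟩⟩
  set D : Set (Mat k) := {X : Mat k | X.PosSemidef ∧ X.trace = 1} with hD
  have hDc : IsCompact D := isCompact_density
  have hft : Continuous fun X : Mat k => (φ X).trace.re :=
    Complex.continuous_re.comp (continuous_end φ).matrix_trace
  obtain ⟨C, hC⟩ := (hDc.image hft).bddAbove
  set K : Set (ℝ × Mat k) :=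
    {x | (0 ≤ x.1 ∧ x.2 ∈ D) ∧ (φ x.2 - (x.1 : ℂ) • x.2).PosSemidef} with hK
  have hKc : IsCompact K := by
    refine (isCompact_Icc (a := (0 : ℝ)) (b := C)).prod hDc |>.of_isClosed_subset ?_ ?_
    · refine IsClosed.inter (IsClosed.inter ?_ ?_) ?_
      · exact isClosed_Ici.preimage continuous_fst
      · exact hDc.isClosed.preimage continuous_snd
      · refine isClosed_setOf_posSemidef.preimage
          (f := fun x : ℝ × Mat k => φ x.2 - (x.1 : ℂ) • x.2) ?_
        exact ((continuous_end φ).comp continuous_snd).sub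
          ((Complex.continuous_ofReal.comp continuous_fst).smul continuous_snd)
    · rintro ⟨t, X⟩ ⟨⟨ht, hX⟩, h⟩
      refine ⟨⟨ht, ?_⟩, hX⟩
      have h1 := (Complex.le_def.mp h.trace_nonneg).1
      have h2 : (φ X).trace.re ≤ C := hC ⟨X, hX, rfl⟩
      rw [trace_sub, trace_smul, hX.2] at h1
      simp at h1
      exact h1.trans h2
  have hnormalize : ∀ (t : ℝ) (Y : Mat k), 0 ≤ t → Y.PosSemidef → Y ≠ 0 →
      (φ Y - (t : ℂ) • Y).PosSemidef → (t, ((Y.trace.re)⁻¹ : ℂ) • Y) ∈ K := by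
    intro t Y ht hY hY0 h
    have htr := hY.trace_nonneg
    have htr0 : Y.trace ≠ 0 := fun h0 => hY0 (hY.trace_eq_zero_iff.mp h0)
    have hre : Y.trace = (Y.trace.re : ℂ) := by
      rw [← Complex.eq_re_of_ofReal_le (r := 0) (by simpa using htr)]
    have hpos : 0 ≤ (Y.trace.re)⁻¹ := inv_nonneg.mpr (Complex.le_def.mp htr).1
    refine ⟨⟨ht, ?_, ?_⟩, ?_⟩
    · have := hY.real_smul hpos
      rwa [Complex.ofReal_inv] at this
    · rw [trace_smul, ← hre, smul_eq_mul, inv_mul_cancel₀ htr0]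
    · have := h.real_smul hpos
      rw [Complex.ofReal_inv] at this
      rwa [map_smul, smul_comm, ← smul_sub]
  have hKne : K.Nonempty := by
    refine ⟨_, hnormalize 0 1 le_rfl PosSemidef.one one_ne_zero ?_⟩
    simpa using hφ 1 PosSemidef.one
  obtain ⟨⟨r, X⟩, ⟨⟨hr, hX, htX⟩, hrX⟩, hmax⟩ :=
    hKc.exists_isMaxOn hKne continuous_fst.continuousOn
  have hX0 : X ≠ 0 := by
    rintro rfl
    simp at htX
  -- otherwise `(1 + φ) ^ N` turns `r X ≤ φ X` into a strict inequality, and `r` could be enlarged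
  have hZ : φ X - (r : ℂ) • X = 0 := by
    by_contra hZ
    obtain ⟨N, hN⟩ := hφ.exists_pow_posDef hirr hrX hZ
    set Y := ((1 + φ) ^ N) X with hYdef
    have hY : Y.PosSemidef := hφ.one_add_pow N X hX
    rw [map_sub, map_smul, ← apply_one_add_pow_comm, ← hYdef] at hN
    have hY0 : Y ≠ 0 := by
      intro h0
      rw [h0] at hN
      have := hN.trace_pos
      simp at this
    obtain ⟨c, hc, h⟩ := hN.exists_posSemidef_smul_sub hY.isHermitian
    have hc' : (c : ℂ) ≠ 0 := by exact_mod_cast hc.ne'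
    have h' := h.real_smul (inv_nonneg.mpr hc.le)
    have h2 : (φ Y - ((r + c⁻¹ : ℝ) : ℂ) • Y).PosSemidef := by
      convert h' using 1
      push_cast
      rw [smul_sub, smul_smul, inv_mul_cancel₀ hc', one_smul, add_smul]
      abel
    have := hmax (hnormalize (r + c⁻¹) Y (by positivity) hY hY0 h2)
    have h3 : 0 < c⁻¹ := by positivity
    simp at this
    linarith
  obtain ⟨N, hN⟩ := hφ.exists_pow_posDef hirr hX hX0
  refine ⟨r, hr, _, hN, ?_⟩
  rw [apply_one_add_pow_comm, sub_eq_zero.mp hZ, map_smul]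

/-- Positive definite eigenmatrices of an irreducible positive map, for the same eigenvalue, are
proportional: subtracting the largest possible multiple leaves a singular positive semidefinite
eigenmatrix, which must vanish. -/
lemma IsPositiveMap.eigen_unique (hk : 0 < k) {φ : Module.End ℂ (Mat k)} (hφ : IsPositiveMap φ)
    (hirr : IsIrreducible φ) {r : ℝ} (hr : 0 ≤ r) {ρ ρ' : Mat k} (hρ : ρ.PosDef)
    (hρ' : ρ'.PosDef) (h : φ ρ = (r : ℂ) • ρ) (h' : φ ρ' = (r : ℂ) • ρ') :
    ∃ t : ℝ, ρ = (t : ℂ) • ρ' := by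
  have : Nonempty (Fin k) := ⟨⟨0, hk⟩⟩
  set S : Set ℝ := {t | 0 ≤ t ∧ (ρ - (t : ℂ) • ρ').PosSemidef} with hS
  have hSc : IsCompact S := by
    refine (isCompact_Icc (a := (0 : ℝ)) (b := ρ.trace.re / ρ'.trace.re)).of_isClosed_subset ?_ ?_
    · refine IsClosed.inter isClosed_Ici (isClosed_setOf_posSemidef.preimage
          (f := fun t : ℝ => ρ - (t : ℂ) • ρ') ?_)
      exact continuous_const.sub (Complex.continuous_ofReal.smul continuous_const)
    · rintro t ⟨ht, h1⟩
      refine ⟨ht, ?_⟩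
      have h2 := (Complex.le_def.mp h1.trace_nonneg).1
      have h3 : 0 < ρ'.trace.re := (Complex.lt_def.mp hρ'.trace_pos).1
      rw [trace_sub, trace_smul] at h2
      simp at h2
      rwa [le_div_iff₀ h3]
  obtain ⟨t, ⟨ht, htS⟩, hmax⟩ := hSc.exists_isMaxOn
    ⟨0, le_rfl, by simpa using hρ.posSemidef⟩ continuous_id.continuousOn
  refine ⟨t, ?_⟩
  by_contra hne
  have hne' : ρ - (t : ℂ) • ρ' ≠ 0 := fun h0 => hne (sub_eq_zero.mp h0)
  have heig : (1 + φ) (ρ - (t : ℂ) • ρ') = ((1 + r : ℝ) : ℂ) • (ρ - (t : ℂ) • ρ') := by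
    rw [LinearMap.add_apply, Module.End.one_apply, map_sub, map_smul, h, h', smul_comm (t : ℂ),
      ← smul_sub]
    push_cast
    rw [add_smul, one_smul]
  obtain ⟨N, hN⟩ := hφ.exists_pow_posDef hirr htS hne'
  rw [pow_apply_of_eigen heig] at hN
  have h1r : (0 : ℝ) < ((1 + r) ^ N)⁻¹ := by positivity
  have hpd : (ρ - (t : ℂ) • ρ').PosDef := by
    have := hN.smul (a := ((((1 + r) ^ N)⁻¹ : ℝ) : ℂ)) (by exact_mod_cast h1r)
    rwa [smul_smul, ← Complex.ofReal_pow, ← Complex.ofReal_mul,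
      inv_mul_cancel₀ (by positivity), Complex.ofReal_one, one_smul] at this
  obtain ⟨c, hc, hcp⟩ := hpd.exists_posSemidef_smul_sub hρ'.isHermitian
  have hc' : (c : ℂ) ≠ 0 := by exact_mod_cast hc.ne'
  have hmem : t + c⁻¹ ∈ S := by
    refine ⟨by positivity, ?_⟩
    convert hcp.real_smul (inv_nonneg.mpr hc.le) using 1
    push_cast
    rw [smul_sub, smul_smul, inv_mul_cancel₀ hc', one_smul, add_smul]
    abel
  have := hmax hmem
  have h3 : 0 < c⁻¹ := by positivity
  simp at this
  linarith

/-- A positive map with a positive definite eigenmatrix of eigenvalue `r` has spectral radius `r`: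
on the order interval `[-c ρ, c ρ]` its `N`-th power grows at most like `r ^ N`. -/
lemma IsPositiveMap.spectralRadius_eq (hk : 0 < k) {φ : Module.End ℂ (Mat k)}
    (hφ : IsPositiveMap φ) {r : ℝ} (hr : 0 ≤ r) {ρ : Mat k} (hρ : ρ.PosDef)
    (h : φ ρ = (r : ℂ) • ρ) : spectralRadius ℂ φ = ENNReal.ofReal r := by
  have : Nonempty (Fin k) := ⟨⟨0, hk⟩⟩
  have hρ0 : ρ ≠ 0 := by
    rintro rfl
    have := hρ.trace_pos
    simp at this
  have hmem : (r : ℂ) ∈ spectrum ℂ φ :=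
    Module.End.HasEigenvalue.mem_spectrum
      (Module.End.hasEigenvalue_of_hasEigenvector
        ⟨Module.End.mem_eigenspace_iff.mpr h, hρ0⟩)
  -- the matrices whose iterates are `O(r ^ N)` form a subspace containing the positive cone
  let B : Submodule ℂ (Mat k) :=
    { carrier := {X | ∃ C : ℝ, ∀ N i j, ‖(φ ^ N) X i j‖ ≤ C * r ^ N}
      zero_mem' := ⟨0, fun N i j => by simp⟩
      add_mem' := by
        rintro X Y ⟨C, hC⟩ ⟨C', hC'⟩
        refine ⟨C + C', fun N i j => ?_⟩
        rw [map_add, add_mul]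
        exact (norm_add_le _ _).trans (add_le_add (hC N i j) (hC' N i j))
      smul_mem' := by
        rintro c X ⟨C, hC⟩
        refine ⟨‖c‖ * C, fun N i j => ?_⟩
        rw [map_smul, Matrix.smul_apply, smul_eq_mul, norm_mul, mul_assoc]
        exact mul_le_mul_of_nonneg_left (hC N i j) (norm_nonneg _) }
  have hpsd : ∀ X : Mat k, X.PosSemidef → X ∈ B := by
    intro X hX
    obtain ⟨c, hc, hcX⟩ := hρ.exists_posSemidef_smul_sub hX.isHermitian
    refine ⟨c * ρ.trace.re, fun N i j => ?_⟩
    refine ((hφ.pow N X hX).norm_apply_le_trace i j).trans ?_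
    have h1 := (Complex.le_def.mp (hφ.pow N _ hcX).trace_nonneg).1
    rw [map_sub, map_smul, pow_apply_of_eigen h, smul_smul, trace_sub, trace_smul,
      ← Complex.ofReal_pow, ← Complex.ofReal_mul, smul_eq_mul, Complex.sub_re,
      Complex.re_ofReal_mul, Complex.zero_re] at h1
    linarith
  have hherm : ∀ X : Mat k, X.IsHermitian → X ∈ B := by
    intro X hX
    obtain ⟨c, hc, hcX⟩ := hX.exists_posSemidef_smul_one_sub
    have := B.sub_mem (hpsd _ ((PosSemidef.one (n := Fin k) (R := ℂ)).real_smul hc.le)) (hpsd _ hcX)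
    simpa using this
  have hall : ∀ X : Mat k, X ∈ B := by
    intro X
    have e : X = ((realPart X : Mat k)) + Complex.I • (imaginaryPart X : Mat k) :=
      (realPart_add_I_smul_imaginaryPart X).symm
    rw [e]
    exact B.add_mem (hherm _ (realPart X).2) (B.smul_mem _ (hherm _ (imaginaryPart X).2))
  have hbound : ∀ α ∈ spectrum ℂ φ, ‖α‖ ≤ r := by
    intro α hα
    obtain ⟨X, hX⟩ := (Module.End.hasEigenvalue_iff_mem_spectrum.mpr hα).exists_hasEigenvector
    obtain ⟨C, hC⟩ := hall X
    obtain ⟨i, j, hij⟩ : ∃ i j, X i j ≠ 0 := by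
      by_contra hcon
      push Not at hcon
      exact hX.2 (Matrix.ext hcon)
    by_contra hlt
    push Not at hlt
    have hα0 : 0 < ‖α‖ := hr.trans_lt hlt
    have hle : ∀ N : ℕ, ‖X i j‖ ≤ C * (r / ‖α‖) ^ N := by
      intro N
      have := hC N i j
      rw [pow_apply_of_eigen (Module.End.mem_eigenspace_iff.mp hX.1), Matrix.smul_apply,
        smul_eq_mul, norm_mul, norm_pow] at this
      rw [div_pow, ← mul_div_assoc, le_div_iff₀ (by positivity)]
      linarith
    have hlim : Filter.Tendsto (fun N : ℕ => C * (r / ‖α‖) ^ N) Filter.atTop (nhds (C * 0)) :=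
      (tendsto_pow_atTop_nhds_zero_of_lt_one (by positivity)
        ((div_lt_one hα0).mpr hlt)).const_mul C
    have := ge_of_tendsto' hlim hle
    rw [mul_zero] at this
    exact hij (norm_le_zero_iff.mp this)
  have hnr : ENNReal.ofReal r = ((‖(r : ℂ)‖₊ : NNReal) : ENNReal) := by
    rw [ENNReal.ofReal]
    congr 1
    ext
    simp [hr, abs_of_nonneg hr]
  refine le_antisymm (iSup₂_le fun α hα => ?_) ?_
  · rw [ENNReal.ofReal, ENNReal.coe_le_coe]
    exact NNReal.le_toNNReal_of_coe_le (hbound α hα)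
  · rw [hnr]
    exact le_iSup₂ (f := fun α (_ : α ∈ spectrum ℂ φ) => ((‖α‖₊ : NNReal) : ENNReal)) (r : ℂ) hmem

/-- If `p` spans an invariant face of the dual map `ψ`, then `1 - p` spans one of `φ`. -/
lemma IsIrreducible.dual {φ ψ : Module.End ℂ (Mat k)} (hφ : IsPositiveMap φ)
    (hψ : IsPositiveMap ψ) (hirr : IsIrreducible φ)
    (hdual : ∀ X Y, (φ X * Y).trace = (X * ψ Y).trace) : IsIrreducible ψ := by
  rintro ⟨c, p, hc, hp, hp0, hp1, h⟩
  have hq : IsStarProjection (1 - p) := hp.one_sub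
  have hqs := posSemidef_of_isStarProjection hq
  have hps := posSemidef_of_isStarProjection hp
  have h1 : ((1 - p) * ψ p).trace = 0 := by
    refine le_antisymm ?_ (trace_mul_nonneg hqs (hψ p hps))
    have h2 := trace_mul_nonneg hqs h
    have h3 : (1 - p) * p = 0 := by rw [Matrix.sub_mul, Matrix.one_mul, hp.isIdempotentElem.eq,
      sub_self]
    rw [Matrix.mul_sub, Matrix.mul_smul, h3, smul_zero, zero_sub, trace_neg, neg_nonneg] at h2
    exact h2
  rw [← hdual] at h1
  have h2 : φ (1 - p) * (1 - (1 - p)) = 0 := by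
    rw [sub_sub_cancel]
    exact (hφ _ hqs).mul_eq_zero_of_trace_mul_eq_zero hps h1
  obtain ⟨c', hc', h3⟩ := (hφ _ hqs).exists_posSemidef_smul_sub hq h2
  refine hirr ⟨c', 1 - p, hc', hq, fun h0 => hp1 (sub_eq_zero.mp h0).symm, fun h0 => hp0 ?_, h3⟩
  simpa using h0

end QChannel

/-! ### Channels as positive maps -/

namespace QChannel

variable {k : ℕ} {μ : Measure (Mat k)}

instance matSecondCountable (k : ℕ) : SecondCountableTopology (Mat k) :=
  inferInstanceAs (SecondCountableTopology (Fin k → Fin k → ℂ))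

lemma SquareIntegrable.entry_mul {L : Mat k → Mat k} (h : SquareIntegrable μ L) (X Y : Mat k)
    (i j : Fin k) : Integrable (fun v => (Y * (L v * X * (L v)ᴴ)) i j) μ := by
  simp only [Matrix.mul_apply (M := Y)]
  exact integrable_finsetSum _ fun l _ => (h.entry X l j).const_mul _

lemma SquareIntegrable.trace_mul {L : Mat k → Mat k} (h : SquareIntegrable μ L) (X Y : Mat k) :
    Integrable (fun v => (Y * (L v * X * (L v)ᴴ)).trace) μ :=
  integrable_finsetSum _ fun i _ => h.entry_mul X Y i i

lemma integral_trace_mul {L : Mat k → Mat k} (h : SquareIntegrable μ L) (X Y : Mat k) :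
    ∫ v, (Y * (L v * X * (L v)ᴴ)).trace ∂μ = (Y * channel μ L X).trace := by
  rw [Matrix.trace_mul_comm, channel_apply h, trace_matIntegral_mul (h.entry X)]
  exact integral_congr_ae (.of_forall fun v => Matrix.trace_mul_comm _ _)

lemma SquareIntegrable.trace {L : Mat k → Mat k} (h : SquareIntegrable μ L) (X : Mat k) :
    Integrable (fun v => (L v * X * (L v)ᴴ).trace) μ := by
  simpa using h.trace_mul X 1

lemma integral_trace {L : Mat k → Mat k} (h : SquareIntegrable μ L) (X : Mat k) :
    ∫ v, (L v * X * (L v)ᴴ).trace ∂μ = (channel μ L X).trace := by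
  simpa using integral_trace_mul h X 1

lemma integral_re_trace {L : Mat k → Mat k} (h : SquareIntegrable μ L) (X : Mat k) :
    ∫ v, (L v * X * (L v)ᴴ).trace.re ∂μ = (channel μ L X).trace.re := by
  rw [← integral_trace h]
  exact integral_re (h.trace X)

lemma channel_conjTranspose {L : Mat k → Mat k} (h : SquareIntegrable μ L) (X : Mat k) :
    (channel μ L X)ᴴ = channel μ L Xᴴ := by
  rw [channel_apply h, channel_apply h]
  ext i j
  simp only [matIntegral, Matrix.conjTranspose_apply, Matrix.of_apply, Complex.star_def]
  rw [← integral_conj]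
  congr 1
  funext v
  change (L v * X * (L v)ᴴ)ᴴ i j = _
  simp only [Matrix.conjTranspose_mul, Matrix.conjTranspose_conjTranspose, Matrix.mul_assoc]

lemma isPositiveMap_channel {L : Mat k → Mat k} (h : SquareIntegrable μ L) :
    IsPositiveMap (channel μ L) := by
  intro A hA
  refine PosSemidef.of_dotProduct_mulVec_nonneg ?_ fun x => ?_
  · rw [IsHermitian, channel_conjTranspose h, hA.isHermitian.eq]
  · have e : ∀ M : Mat k, star x ⬝ᵥ M *ᵥ x = (vecMulVec x (star x) * M).trace := by
      intro M
      rw [Matrix.trace_mul_comm, Matrix.mul_vecMulVec, trace_vecMulVec, dotProduct_comm]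
    rw [e, ← integral_trace_mul h]
    exact integral_nonneg fun v => trace_mul_nonneg (posSemidef_vecMulVec_self_star x)
      (hA.mul_mul_conjTranspose_same (L v))

/-- `φ_L^*` is the dual of `φ_L` for the bilinear pairing `tr (X Y)`. -/
lemma trace_channel_mul' {L : Mat k → Mat k} (h : SquareIntegrable μ L) (X Y : Mat k) :
    (channel μ L X * Y).trace = (X * dualChannel μ L Y).trace := by
  have h1 := trace_channel_mul h X Yᴴ
  have h2 : (dualChannel μ L Yᴴ)ᴴ = dualChannel μ L Y := by
    rw [dualChannel, channel_conjTranspose h.conjTranspose, conjTranspose_conjTranspose]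
  rwa [h2, conjTranspose_conjTranspose] at h1

/-- The Perron–Frobenius theorem for an irreducible nonzero map `φ_L`. -/
theorem perronFrobenius (hk : 0 < k) {L : Mat k → Mat k} (h : SquareIntegrable μ L)
    (hirr : IsIrreducible (channel μ L)) (h1 : channel μ L 1 ≠ 0) :
    0 < specRadius μ L ∧ (∃! ρ, IsEigenDensity μ L ρ) ∧ (∃! σ, IsDualEigenmatrix μ L σ) := by
  have : Nonempty (Fin k) := ⟨⟨0, hk⟩⟩
  have hφ := isPositiveMap_channel h
  have hψ : IsPositiveMap (dualChannel μ L) := isPositiveMap_channel h.conjTranspose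
  have hirr' := hirr.dual hφ hψ (trace_channel_mul' h)
  obtain ⟨r, hr, ρ, hρ, hρr⟩ := hφ.exists_posDef_eigen hk hirr
  obtain ⟨s, hs, σ, hσ, hσs⟩ := hψ.exists_posDef_eigen hk hirr'
  have hne : ∀ {ρ : Mat k}, ρ.PosDef → ρ ≠ 0 := by
    rintro _ hρ rfl
    have := hρ.trace_pos
    simp at this
  have hsr : specRadius μ L = r := by
    rw [specRadius, hφ.spectralRadius_eq hk hr hρ hρr, ENNReal.toReal_ofReal hr]
  -- pairing the eigenmatrices of the map and of its dual identifies the eigenvalues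
  have hrs : (s : ℂ) = r := by
    have e := trace_channel_mul' h ρ σ
    rw [hρr, hσs, Matrix.smul_mul, Matrix.mul_smul, trace_smul, trace_smul, smul_eq_mul,
      smul_eq_mul, Matrix.trace_mul_comm] at e
    exact (mul_right_cancel₀ (hσ.trace_mul_pos hρ.posSemidef (hne hρ)).ne'
      (e.trans (by rw [Matrix.trace_mul_comm]))).symm
  -- if `r = 0`, then `1 ≤ c ρ` gives `φ_L(1) ≤ 0`
  have hr0 : 0 < r := by
    refine lt_of_le_of_ne hr fun h0 => h1 ?_
    obtain ⟨c, hc, hcρ⟩ := hρ.exists_posSemidef_smul_sub (isHermitian_one (n := Fin k) (α := ℂ))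
    refine (hφ 1 PosSemidef.one).eq_zero_of_neg ?_
    have := hφ _ hcρ
    rwa [map_sub, map_smul, hρr, ← h0, Complex.ofReal_zero, zero_smul, smul_zero, zero_sub] at this
  have hex : ∃ ρ, IsEigenDensity μ L ρ := by
    refine ⟨(ρ.trace)⁻¹ • ρ, hρ.smul (inv_pos.mpr hρ.trace_pos), ?_, ?_⟩
    · rw [trace_smul, smul_eq_mul, inv_mul_cancel₀ hρ.trace_pos.ne']
    · rw [map_smul, hρr, hsr, smul_comm]
  have hR : IsEigenDensity μ L (rhoOf μ L) := Classical.epsilon_spec hex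
  refine ⟨hsr ▸ hr0, ?_, ?_⟩
  · refine ⟨rhoOf μ L, hR, fun ρ' hρ' => ?_⟩
    obtain ⟨t, ht⟩ := hφ.eigen_unique hk hirr hr hρ'.1 hR.1 (hsr ▸ hρ'.2.2) (hsr ▸ hR.2.2)
    have := congrArg Matrix.trace ht
    rw [trace_smul, hρ'.2.1, hR.2.1, smul_eq_mul, mul_one] at this
    rw [ht, ← this, one_smul]
  · have hpos := hσ.trace_mul_pos hR.1.posSemidef (hne hR.1)
    have hS : IsDualEigenmatrix μ L ((σ * rhoOf μ L).trace⁻¹ • σ) := by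
      refine ⟨hσ.smul (inv_pos.mpr hpos), ?_, ?_⟩
      · rw [Matrix.smul_mul, trace_smul, smul_eq_mul, inv_mul_cancel₀ hpos.ne']
      · rw [map_smul, hσs, hsr, hrs, smul_comm]
    refine ⟨_, hS, fun σ' hσ' => ?_⟩
    obtain ⟨t, ht⟩ := hψ.eigen_unique hk hirr' hr hσ'.1 hS.1 (hsr ▸ hσ'.2.2) (hsr ▸ hS.2.2)
    have := congrArg (fun M => (M * rhoOf μ L).trace) ht
    rw [Matrix.smul_mul, trace_smul, hσ'.2.1, hS.2.1, smul_eq_mul, mul_one] at this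
    rw [ht, ← this, one_smul]

lemma trace_channel_one_re {L : Mat k → Mat k} (h : SquareIntegrable μ L) :
    (channel μ L 1).trace.re = ∫ v, hsNorm (L v) ^ 2 ∂μ := by
  rw [← integral_re_trace h]
  refine integral_congr_ae (.of_forall fun v => ?_)
  simp only [Matrix.mul_one, hsNorm]
  rw [Real.sq_sqrt]
  exact (Complex.le_def.mp (posSemidef_self_mul_conjTranspose (L v)).trace_nonneg).1

lemma hsNorm_sq_pos {A : Mat k} (hA : A ≠ 0) : 0 < hsNorm A ^ 2 := by
  obtain ⟨i, j, hij⟩ : ∃ i j, A i j ≠ 0 := by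
    by_contra hcon
    push Not at hcon
    exact hA (Matrix.ext hcon)
  exact lt_of_lt_of_le (by positivity) (norm_sq_le_hsNorm_sq A i j)

/-- A measure carrying an integrable almost everywhere positive function is σ-finite. -/
lemma sigmaFinite_of_integrable_pos {α : Type*} [MeasurableSpace α] {μ : Measure α} {f : α → ℝ}
    (hf : Integrable f μ) (hpos : ∀ᵐ x ∂μ, 0 < f x) : SigmaFinite μ := by
  obtain ⟨t, htm, ht, hσ⟩ := hf.aefinStronglyMeasurable.exists_set_sigmaFinite
  have h0 : μ tᶜ = 0 := by
    rw [Filter.EventuallyEq, ae_restrict_iff' htm.compl] at ht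
    rw [measure_eq_zero_iff_ae_notMem]
    filter_upwards [ht, hpos] with x hx hx'
    exact fun hxt => hx'.ne' (hx hxt)
  rwa [Measure.restrict_eq_self_of_ae_mem] at hσ
  filter_upwards [measure_eq_zero_iff_ae_notMem.mp h0] with x hx
  simpa using hx

end QChannel

/-! ### Relative entropy of stationary Markov densities -/

namespace QChannel

section MarkovDensity

variable {α : Type*} [MeasurableSpace α] {μ : Measure α}

/-- A stationary Markov chain with probability density `r` and transition density `T` with respect
to a reference measure: `r T` has both marginals equal to `r`. -/
structure IsMarkovDensity (μ : Measure α) (r : α → ℝ) (T : α → α → ℝ) : Prop where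
  measurable_density : Measurable r
  measurable_transition : Measurable (Function.uncurry T)
  density_nonneg : ∀ v, 0 ≤ r v
  transition_nonneg : ∀ v w, 0 ≤ T v w
  integrable_density : Integrable r μ
  integral_density : ∫ v, r v ∂μ = 1
  integrable_row : ∀ v, Integrable (fun w => r v * T v w) μ
  integral_row : ∀ v, ∫ w, r v * T v w ∂μ = r v
  integrable_col : ∀ w, Integrable (fun v => r v * T v w) μ
  integral_col : ∀ w, ∫ v, r v * T v w ∂μ = r w

namespace IsMarkovDensity

variable {r : α → ℝ} {T : α → α → ℝ} [SFinite μ]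

lemma integrable_prod_iff (h : IsMarkovDensity μ r T) {f : α → ℝ} (hf : Measurable f) :
    Integrable (fun x : α × α => r x.1 * T x.1 x.2 * f x.2) (μ.prod μ) ↔
      Integrable (fun w => r w * f w) μ := by
  have hm : Measurable fun x : α × α => r x.1 * T x.1 x.2 * f x.2 :=
    ((h.measurable_density.comp measurable_fst).mul h.measurable_transition).mul
      (hf.comp measurable_snd)
  rw [MeasureTheory.integrable_prod_iff' hm.aestronglyMeasurable]
  have e : ∀ w, ∫ v, ‖r v * T v w * f w‖ ∂μ = ‖r w * f w‖ := by
    intro w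
    simp only [norm_mul (_ * _) (f w)]
    rw [integral_mul_const, norm_mul]
    congr 1
    rw [Real.norm_of_nonneg (h.density_nonneg w), ← h.integral_col w]
    exact integral_congr_ae (.of_forall fun v =>
      Real.norm_of_nonneg (mul_nonneg (h.density_nonneg v) (h.transition_nonneg v w)))
  simp only [e]
  have hrf : Measurable fun w => r w * f w := h.measurable_density.mul hf
  rw [integrable_norm_iff hrf.aestronglyMeasurable]
  exact and_iff_right (.of_forall fun w => (h.integrable_col w).mul_const _)

lemma integral_prod_eq (h : IsMarkovDensity μ r T) {f : α → ℝ} (hf : Measurable f)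
    (hi : Integrable (fun w => r w * f w) μ) :
    ∫ x : α × α, r x.1 * T x.1 x.2 * f x.2 ∂μ.prod μ = ∫ w, r w * f w ∂μ := by
  rw [integral_prod_symm _ ((h.integrable_prod_iff hf).mpr hi)]
  simp only [integral_mul_const, h.integral_col]

lemma integrable_joint (h : IsMarkovDensity μ r T) :
    Integrable (fun x : α × α => r x.1 * T x.1 x.2) (μ.prod μ) := by
  simpa using (h.integrable_prod_iff (f := fun _ => 1) measurable_const).mpr
    (by simpa using h.integrable_density)

lemma integral_joint (h : IsMarkovDensity μ r T) :
    ∫ x : α × α, r x.1 * T x.1 x.2 ∂μ.prod μ = 1 := by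
  have := h.integral_prod_eq (f := fun _ => 1) measurable_const
    (by simpa using h.integrable_density)
  simpa [h.integral_density] using this

end IsMarkovDensity

lemma mul_klFun_div {t q : ℝ} (hq : 0 < q) :
    q * InformationTheory.klFun (t / q)
      = t * Real.log t - t * Real.log q + q - t := by
  rw [InformationTheory.klFun_apply]
  rcases eq_or_ne t 0 with rfl | ht
  · simp
  · rw [Real.log_div ht hq.ne']
    field_simp

/-- The density of the relative entropy of a transition density `T` with respect to independent
draws from `q`, weighted by the initial density `r`. -/
noncomputable def relEntropyIntegrand (r : α → ℝ) (T : α → α → ℝ) (q : α → ℝ) (x : α × α) : ℝ :=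
  r x.1 * (q x.2 * InformationTheory.klFun (T x.1 x.2 / q x.2))

namespace IsMarkovDensity

variable {r q : α → ℝ} {T : α → α → ℝ}

lemma relEntropyIntegrand_nonneg (h : IsMarkovDensity μ r T) (hq : ∀ v, 0 ≤ q v) (x : α × α) :
    0 ≤ relEntropyIntegrand r T q x :=
  mul_nonneg (h.density_nonneg _) (mul_nonneg (hq _)
    (InformationTheory.klFun_nonneg (div_nonneg (h.transition_nonneg _ _) (hq _))))

lemma measurable_relEntropyIntegrand (h : IsMarkovDensity μ r T) (hq : Measurable q) :
    Measurable (relEntropyIntegrand r T q) :=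
  (h.measurable_density.comp measurable_fst).mul ((hq.comp measurable_snd).mul
    (InformationTheory.measurable_klFun.comp
      (h.measurable_transition.div (hq.comp measurable_snd))))

lemma relEntropyIntegrand_ae_eq (hqpos : ∀ᵐ w ∂μ, 0 < q w) :
    relEntropyIntegrand r T q =ᵐ[μ.prod μ] fun x =>
      r x.1 * (T x.1 x.2 * Real.log (T x.1 x.2)) - r x.1 * T x.1 x.2 * Real.log (q x.2)
        + r x.1 * q x.2 - r x.1 * T x.1 x.2 := by
  filter_upwards [Measure.quasiMeasurePreserving_snd.ae hqpos] with x hx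
  rw [relEntropyIntegrand, mul_klFun_div hx]
  ring

variable [SFinite μ]

/-- If `r T log T` is integrable, then so is the positive part of `r log q`, because
`T log q ≤ T log T + q - T`. -/
lemma integrable_posPart (h : IsMarkovDensity μ r T) (hqm : Measurable q) (hq : ∀ v, 0 ≤ q v)
    (hqpos : ∀ᵐ w ∂μ, 0 < q w) (hqi : Integrable q μ)
    (he : Integrable (fun x : α × α => r x.1 * (T x.1 x.2 * Real.log (T x.1 x.2))) (μ.prod μ)) :
    Integrable (fun w => r w * max (Real.log (q w)) 0) μ := by
  have hlog : Measurable fun w => max (Real.log (q w)) 0 :=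
    (Real.measurable_log.comp hqm).max measurable_const
  rw [← h.integrable_prod_iff hlog]
  refine (he.norm.add (h.integrable_density.mul_prod hqi)).mono' ?_ ?_
  · exact (((h.measurable_density.comp measurable_fst).mul h.measurable_transition).mul
      (hlog.comp measurable_snd)).aestronglyMeasurable
  · filter_upwards [relEntropyIntegrand_ae_eq (r := r) (T := T) hqpos] with x hx
    have h1 := h.relEntropyIntegrand_nonneg hq x
    rw [hx] at h1
    have h2 : 0 ≤ r x.1 * T x.1 x.2 := mul_nonneg (h.density_nonneg _) (h.transition_nonneg _ _)
    have h3 : 0 ≤ r x.1 * q x.2 := mul_nonneg (h.density_nonneg _) (hq _)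
    rw [Real.norm_of_nonneg (mul_nonneg h2 (le_max_right _ _))]
    have h4 := Real.le_norm_self (r x.1 * (T x.1 x.2 * Real.log (T x.1 x.2)))
    simp only [Pi.add_apply]
    rcases max_cases (Real.log (q x.2)) 0 with ⟨e, -⟩ | ⟨e, -⟩ <;> rw [e]
    · linarith
    · have := norm_nonneg (r x.1 * (T x.1 x.2 * Real.log (T x.1 x.2)))
      linarith

lemma integrable_relEntropy (h : IsMarkovDensity μ r T) (hqm : Measurable q)
    (hqpos : ∀ᵐ w ∂μ, 0 < q w) (hqi : Integrable q μ)
    (he : Integrable (fun x : α × α => r x.1 * (T x.1 x.2 * Real.log (T x.1 x.2))) (μ.prod μ))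
    (hl : Integrable (fun w => r w * Real.log (q w)) μ) :
    Integrable (relEntropyIntegrand r T q) (μ.prod μ) := by
  rw [integrable_congr (relEntropyIntegrand_ae_eq hqpos)]
  exact ((he.sub ((h.integrable_prod_iff (Real.measurable_log.comp hqm)).mpr hl)).add
    (h.integrable_density.mul_prod hqi)).sub h.integrable_joint

lemma integral_relEntropy (h : IsMarkovDensity μ r T) (hqm : Measurable q)
    (hqpos : ∀ᵐ w ∂μ, 0 < q w) (hqi : Integrable q μ) (hq1 : ∫ w, q w ∂μ = 1)
    (he : Integrable (fun x : α × α => r x.1 * (T x.1 x.2 * Real.log (T x.1 x.2))) (μ.prod μ))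
    (hl : Integrable (fun w => r w * Real.log (q w)) μ) :
    ∫ x, relEntropyIntegrand r T q x ∂μ.prod μ
      = (∫ x : α × α, r x.1 * (T x.1 x.2 * Real.log (T x.1 x.2)) ∂μ.prod μ)
        - ∫ w, r w * Real.log (q w) ∂μ := by
  have hlog : Measurable fun w => Real.log (q w) := Real.measurable_log.comp hqm
  have hl' := (h.integrable_prod_iff hlog).mpr hl
  have hrq := h.integrable_density.mul_prod hqi
  have hsub : Integrable (fun x : α × α => r x.1 * (T x.1 x.2 * Real.log (T x.1 x.2))
      - r x.1 * T x.1 x.2 * Real.log (q x.2)) (μ.prod μ) := he.sub hl'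
  have hadd : Integrable (fun x : α × α => r x.1 * (T x.1 x.2 * Real.log (T x.1 x.2))
      - r x.1 * T x.1 x.2 * Real.log (q x.2) + r x.1 * q x.2) (μ.prod μ) := hsub.add hrq
  rw [integral_congr_ae (relEntropyIntegrand_ae_eq hqpos), integral_sub hadd h.integrable_joint,
    integral_add hsub hrq, integral_sub he hl', h.integral_joint, integral_prod_mul,
    h.integral_density, hq1, h.integral_prod_eq hlog hl]
  ring

/-- The relative entropy vanishes exactly when the chain consists of independent draws from
`q`. -/
lemma integral_relEntropy_eq_zero_iff (h : IsMarkovDensity μ r T) (hqm : Measurable q)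
    (hq : ∀ v, 0 ≤ q v) (hqpos : ∀ᵐ w ∂μ, 0 < q w)
    (hi : Integrable (relEntropyIntegrand r T q) (μ.prod μ)) :
    ∫ x, relEntropyIntegrand r T q x ∂μ.prod μ = 0 ↔
      ∀ᵐ v ∂μ, r v ≠ 0 → ∀ᵐ w ∂μ, T v w = q w := by
  rw [integral_eq_zero_iff_of_nonneg (h.relEntropyIntegrand_nonneg hq) hi]
  have hms : MeasurableSet {x | relEntropyIntegrand r T q x = (0 : α × α → ℝ) x} :=
    measurableSet_eq_fun (h.measurable_relEntropyIntegrand hqm) measurable_const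
  rw [Filter.EventuallyEq, Measure.ae_prod_iff_ae_ae hms]
  refine Filter.eventually_congr (.of_forall fun v => ?_)
  by_cases hv : r v = 0
  · simp [relEntropyIntegrand, hv]
  · simp only [ne_eq, hv, not_false_eq_true, forall_const]
    refine Filter.eventually_congr ?_
    filter_upwards [hqpos] with w hw
    simp only [relEntropyIntegrand, Pi.zero_apply, mul_eq_zero, hv, hw.ne', false_or]
    rw [InformationTheory.klFun_eq_zero_iff (div_nonneg (h.transition_nonneg _ _) hw.le),
      div_eq_one_iff_eq hw.ne']

/-- For independent draws from `q`, finite entropy is integrability of `r log q`. -/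
lemma integrable_mul_log_of_ae_eq (h : IsMarkovDensity μ r T) (hqm : Measurable q)
    (he : Integrable (fun x : α × α => r x.1 * (T x.1 x.2 * Real.log (T x.1 x.2))) (μ.prod μ))
    (hT : ∀ᵐ v ∂μ, r v ≠ 0 → ∀ᵐ w ∂μ, T v w = q w) :
    Integrable (fun w => r w * Real.log (q w)) μ := by
  rw [← h.integrable_prod_iff (f := fun w => Real.log (q w)) (Real.measurable_log.comp hqm)]
  refine he.congr ?_
  have hms : MeasurableSet {x : α × α | r x.1 = 0 ∨ T x.1 x.2 = q x.2} :=
    (measurableSet_eq_fun (h.measurable_density.comp measurable_fst) measurable_const).union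
      (measurableSet_eq_fun h.measurable_transition (hqm.comp measurable_snd))
  have : ∀ᵐ x ∂μ.prod μ, r x.1 = 0 ∨ T x.1 x.2 = q x.2 := by
    rw [Measure.ae_prod_iff_ae_ae hms]
    filter_upwards [hT] with v hv
    by_cases h0 : r v = 0
    · exact .of_forall fun w => .inl h0
    · filter_upwards [hv h0] with w hw using .inr hw
  filter_upwards [this] with x hx
  rcases hx with hx | hx
  · simp [hx]
  · simp only [hx]
    ring

end IsMarkovDensity

end MarkovDensity

section Variational

variable {k : ℕ} {μ : Measure (Mat k)}

lemma extIntegral_of_integrable {f : Mat k → ℝ} (hf : Integrable f μ) :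
    extIntegral μ f = ((∫ v, f v ∂μ : ℝ) : EReal) := by
  rw [extIntegral, integral_eq_lintegral_pos_part_sub_lintegral_neg_part hf, EReal.coe_sub,
    EReal.coe_ennreal_toReal, EReal.coe_ennreal_toReal]
  · have := hf.neg.lintegral_lt_top.ne
    simpa using this
  · exact hf.lintegral_lt_top.ne

lemma extIntegral_of_not_integrable {f : Mat k → ℝ} (hfm : AEStronglyMeasurable f μ)
    (hpos : Integrable (fun v => max (f v) 0) μ) (hf : ¬ Integrable f μ) :
    extIntegral μ f = ⊥ := by
  have h1 : ∫⁻ v, ENNReal.ofReal (-f v) ∂μ = ⊤ := by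
    by_contra htop
    refine hf ?_
    have hneg : Integrable (fun v => max (-f v) 0) μ := by
      refine ⟨(hfm.aemeasurable.neg.max aemeasurable_const).aestronglyMeasurable, ?_⟩
      have h0 : 0 ≤ᵐ[μ] fun v => max (-f v) 0 := .of_forall fun v => le_max_right _ _
      rw [hasFiniteIntegral_iff_ofReal h0]
      refine lt_of_le_of_lt (lintegral_mono fun v => ?_) (lt_top_iff_ne_top.mpr htop)
      rcases le_total (-f v) 0 with h | h
      · simp [h]
      · rw [max_eq_left h]
    refine (hpos.sub hneg).congr (.of_forall fun v => ?_)
    simp only [Pi.sub_apply]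
    rcases le_total (f v) 0 with h | h
    · rw [max_eq_right h, max_eq_left (by linarith)]; ring
    · rw [max_eq_left h, max_eq_right (by linarith)]; ring
  rw [extIntegral, h1, EReal.coe_ennreal_top, EReal.sub_top]

end Variational

end QChannel

/-! ### The free energy of a stochastic map -/

namespace QChannel

variable {k : ℕ} {μ : Measure (Mat k)}

section Stochastic

variable {L : Mat k → Mat k}

lemma trace_channel_of_stochastic (hL : L ∈ stochasticIrreducible μ) (X : Mat k) :
    (channel μ L X).trace = X.trace := by
  simpa [hL.2.2] using trace_channel_mul' hL.1 X 1

lemma perronFrobenius_of_stochastic (hk : 0 < k) (hL : L ∈ stochasticIrreducible μ) :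
    0 < specRadius μ L ∧ (∃! ρ, IsEigenDensity μ L ρ) ∧ (∃! σ, IsDualEigenmatrix μ L σ) := by
  refine perronFrobenius hk hL.1 hL.2.1 fun h0 => ?_
  have h := trace_channel_of_stochastic hL 1
  rw [h0, trace_zero, trace_one, Fintype.card_fin] at h
  exact hk.ne (by exact_mod_cast h)

lemma isEigenDensity_rhoOf (hk : 0 < k) (hL : L ∈ stochasticIrreducible μ) :
    IsEigenDensity μ L (rhoOf μ L) :=
  Classical.epsilon_spec (perronFrobenius_of_stochastic hk hL).2.1.exists

lemma specRadius_of_stochastic (hk : 0 < k) (hL : L ∈ stochasticIrreducible μ) :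
    specRadius μ L = 1 := by
  have hρ := isEigenDensity_rhoOf hk hL
  have h := trace_channel_of_stochastic hL (rhoOf μ L)
  rw [hρ.2.2, trace_smul, hρ.2.1, smul_eq_mul, mul_one] at h
  exact_mod_cast h

lemma channel_rhoOf (hk : 0 < k) (hL : L ∈ stochasticIrreducible μ) :
    channel μ L (rhoOf μ L) = rhoOf μ L := by
  have hρ := isEigenDensity_rhoOf hk hL
  rw [hρ.2.2, specRadius_of_stochastic hk hL, Complex.ofReal_one, one_smul]

lemma measurable_stateDensity (hL : Measurable L) : Measurable (stateDensity μ L) := by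
  have hc : Continuous fun A : Mat k => (A * rhoOf μ L * Aᴴ).trace.re :=
    Complex.continuous_re.comp
      ((continuous_id.matrix_mul continuous_const).matrix_mul
        continuous_id.matrix_conjTranspose).matrix_trace
  exact hc.measurable.comp hL

/-- `r_L P_L` is the joint density of two consecutive outcomes, also where `r_L` vanishes. -/
lemma stateDensity_mul_transition (hρ : (rhoOf μ L).PosSemidef) (v w : Mat k) :
    stateDensity μ L v * transition μ L v w
      = (L w * (L v * rhoOf μ L * (L v)ᴴ) * (L w)ᴴ).trace.re := by
  have hA := hρ.mul_mul_conjTranspose_same (L v)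
  have e : L w * (L v * rhoOf μ L * (L v)ᴴ) * (L w)ᴴ
      = L w * L v * rhoOf μ L * (L v)ᴴ * (L w)ᴴ := by simp only [Matrix.mul_assoc]
  rw [transition, e]
  by_cases h0 : stateDensity μ L v = 0
  · have h1 : L v * rhoOf μ L * (L v)ᴴ = 0 := by
      refine hA.trace_eq_zero_iff.mp (Complex.ext h0 ?_)
      exact (Complex.le_def.mp hA.trace_nonneg).2.symm
    rw [← e, h0, zero_mul, h1]
    simp
  · rw [mul_div_cancel₀ _ h0]

/-- The outcomes of repeated measurements in the invariant state form a stationary chain: rows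
integrate to `r_L` because `φ_L` preserves the trace, columns because `φ_L(ρ_L) = ρ_L`. -/
lemma isMarkovDensity_of_stochastic (hk : 0 < k) (hL : L ∈ stochasticIrreducible μ) :
    IsMarkovDensity μ (stateDensity μ L) (transition μ L) := by
  have hR := isEigenDensity_rhoOf hk hL
  have hρ := hR.1.posSemidef
  have hnonneg : ∀ v, 0 ≤ stateDensity μ L v := fun v =>
    (Complex.le_def.mp (hρ.mul_mul_conjTranspose_same (L v)).trace_nonneg).1
  have hcol : ∀ v w, stateDensity μ L v * transition μ L v w
      = ((L w)ᴴ * L w * (L v * rhoOf μ L * (L v)ᴴ)).trace.re := by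
    intro v w
    rw [stateDensity_mul_transition hρ, Matrix.trace_mul_comm]
    simp only [Matrix.mul_assoc]
  refine ⟨measurable_stateDensity hL.1.1, ?_, hnonneg, ?_, (hL.1.trace _).re, ?_, ?_, ?_, ?_, ?_⟩
  · have hc : Continuous fun x : Mat k × Mat k =>
        (x.2 * x.1 * rhoOf μ L * x.1ᴴ * x.2ᴴ).trace.re :=
      Complex.continuous_re.comp
        ((((continuous_snd.matrix_mul continuous_fst).matrix_mul continuous_const).matrix_mul
          continuous_fst.matrix_conjTranspose).matrix_mul
            continuous_snd.matrix_conjTranspose).matrix_trace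
    exact (hc.measurable.comp ((hL.1.1.comp measurable_fst).prodMk
      (hL.1.1.comp measurable_snd))).div ((measurable_stateDensity hL.1.1).comp measurable_fst)
  · intro v w
    refine div_nonneg ?_ (hnonneg v)
    have := ((hρ.mul_mul_conjTranspose_same (L v)).mul_mul_conjTranspose_same (L w)).trace_nonneg
    simpa only [Matrix.mul_assoc, Complex.zero_re] using (Complex.le_def.mp this).1
  · have h := integral_re_trace hL.1 (rhoOf μ L)
    rwa [channel_rhoOf hk hL, hR.2.1] at h
  · intro v
    simp only [stateDensity_mul_transition hρ]
    exact (hL.1.trace _).re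
  · intro v
    simp only [stateDensity_mul_transition hρ]
    rw [integral_re_trace hL.1, trace_channel_of_stochastic hL]
    rfl
  · intro w
    simp only [hcol]
    exact (hL.1.trace_mul _ _).re
  · intro w
    simp only [hcol]
    have h := integral_trace_mul hL.1 (rhoOf μ L) ((L w)ᴴ * L w)
    have h2 : ∫ v, ((L w)ᴴ * L w * (L v * rhoOf μ L * (L v)ᴴ)).trace.re ∂μ
        = (∫ v, ((L w)ᴴ * L w * (L v * rhoOf μ L * (L v)ᴴ)).trace ∂μ).re :=
      integral_re (hL.1.trace_mul _ _)
    rw [h2, h, channel_rhoOf hk hL, Matrix.mul_assoc, Matrix.trace_mul_comm, stateDensity]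

end Stochastic

section Hamiltonian

variable {H : Mat k → Mat k}

/-- The probability density `q_H = tr (σ_H H ρ_H H†) / λ_H`. -/
noncomputable def gibbsDensity (μ : Measure (Mat k)) (H : Mat k → Mat k) (v : Mat k) : ℝ :=
  hamWeight μ H v / specRadius μ H

lemma channel_one_ne_zero (hμ : μ ≠ 0) (hsq : SquareIntegrable μ H)
    (hne : ∀ᵐ v ∂μ, H v ≠ 0) : channel μ H 1 ≠ 0 := by
  intro h0
  have h := trace_channel_one_re hsq
  rw [h0, trace_zero, Complex.zero_re, eq_comm,
    integral_eq_zero_iff_of_nonneg (fun v => sq_nonneg _) hsq.2] at h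
  refine hμ ?_
  rw [← ae_eq_bot, ← Filter.eventually_false_iff_eq_bot]
  filter_upwards [h, hne] with v hv hv'
  exact (hsNorm_sq_pos hv').ne' hv

/-- The hypotheses on `H` under which the pressure is studied. -/
structure IsHamiltonian (μ : Measure (Mat k)) (H : Mat k → Mat k) : Prop where
  dim_pos : 0 < k
  measure_ne_zero : μ ≠ 0
  squareIntegrable : SquareIntegrable μ H
  irreducible : IsIrreducible (channel μ H)
  ne_zero : ∀ᵐ v ∂μ, H v ≠ 0

namespace IsHamiltonian

lemma perronFrobenius (h : IsHamiltonian μ H) :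
    0 < specRadius μ H ∧ (∃! ρ, IsEigenDensity μ H ρ) ∧ (∃! σ, IsDualEigenmatrix μ H σ) :=
  QChannel.perronFrobenius h.dim_pos h.squareIntegrable h.irreducible
    (channel_one_ne_zero h.measure_ne_zero h.squareIntegrable h.ne_zero)

lemma isEigenDensity (h : IsHamiltonian μ H) : IsEigenDensity μ H (rhoOf μ H) :=
  Classical.epsilon_spec h.perronFrobenius.2.1.exists

lemma isDualEigenmatrix (h : IsHamiltonian μ H) : IsDualEigenmatrix μ H (sigmaOf μ H) :=
  Classical.epsilon_spec h.perronFrobenius.2.2.exists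

/-- Fubini's theorem is available although `μ` is arbitrary: `‖H‖²` is integrable and almost
everywhere positive. -/
lemma sigmaFinite (h : IsHamiltonian μ H) : SigmaFinite μ :=
  sigmaFinite_of_integrable_pos h.squareIntegrable.2 (h.ne_zero.mono fun _ => hsNorm_sq_pos)

lemma hamWeight_eq (μ : Measure (Mat k)) (H : Mat k → Mat k) (v : Mat k) :
    hamWeight μ H v = (sigmaOf μ H * (H v * rhoOf μ H * (H v)ᴴ)).trace.re := by
  rw [hamWeight]
  simp only [Matrix.mul_assoc]

lemma gibbsDensity_nonneg (h : IsHamiltonian μ H) (v : Mat k) : 0 ≤ gibbsDensity μ H v := by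
  refine div_nonneg ?_ h.perronFrobenius.1.le
  rw [hamWeight_eq]
  exact (Complex.le_def.mp (trace_mul_nonneg h.isDualEigenmatrix.1.posSemidef
    (h.isEigenDensity.1.posSemidef.mul_mul_conjTranspose_same (H v)))).1

lemma gibbsDensity_pos (h : IsHamiltonian μ H) : ∀ᵐ v ∂μ, 0 < gibbsDensity μ H v := by
  filter_upwards [h.ne_zero] with v hv
  refine div_pos ?_ h.perronFrobenius.1
  have hρ := h.isEigenDensity.1
  have hA := hρ.posSemidef.mul_mul_conjTranspose_same (H v)
  rw [hamWeight_eq]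
  refine (Complex.lt_def.mp (h.isDualEigenmatrix.1.trace_mul_pos hA fun h0 => hv ?_)).1
  have h1 : (rhoOf μ H * ((H v)ᴴ * H v)).trace = 0 := by
    rw [← Matrix.mul_assoc, Matrix.trace_mul_comm, ← Matrix.mul_assoc, h0, trace_zero]
  by_contra hv'
  exact (hρ.trace_mul_pos (posSemidef_conjTranspose_mul_self (H v))
    (fun h2 => hv' (conjTranspose_mul_self_eq_zero.mp h2))).ne' h1

lemma measurable_gibbsDensity (h : IsHamiltonian μ H) : Measurable (gibbsDensity μ H) := by
  have hc : Continuous fun A : Mat k => (sigmaOf μ H * A * rhoOf μ H * Aᴴ).trace.re :=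
    Complex.continuous_re.comp
      (((continuous_const.matrix_mul continuous_id).matrix_mul continuous_const).matrix_mul
        continuous_id.matrix_conjTranspose).matrix_trace
  exact (hc.measurable.comp h.squareIntegrable.1).div_const _

lemma integrable_gibbsDensity (h : IsHamiltonian μ H) : Integrable (gibbsDensity μ H) μ := by
  have := (h.squareIntegrable.trace_mul (rhoOf μ H) (sigmaOf μ H)).re.div_const (specRadius μ H)
  refine this.congr (.of_forall fun v => ?_)
  simp only [gibbsDensity, hamWeight_eq]
  rfl

lemma integral_gibbsDensity (h : IsHamiltonian μ H) : ∫ v, gibbsDensity μ H v ∂μ = 1 := by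
  simp only [gibbsDensity, hamWeight_eq]
  rw [integral_div, div_eq_one_iff_eq h.perronFrobenius.1.ne']
  have h2 : ∫ v, (sigmaOf μ H * (H v * rhoOf μ H * (H v)ᴴ)).trace.re ∂μ
      = (∫ v, (sigmaOf μ H * (H v * rhoOf μ H * (H v)ᴴ)).trace ∂μ).re :=
    integral_re (h.squareIntegrable.trace_mul _ _)
  rw [h2, integral_trace_mul h.squareIntegrable, h.isEigenDensity.2.2, Matrix.mul_smul, trace_smul,
    h.isDualEigenmatrix.2.1]
  simp

lemma potential_eq (h : IsHamiltonian μ H) :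
    ∀ᵐ v ∂μ, potential μ H v = Real.log (specRadius μ H) + Real.log (gibbsDensity μ H v) := by
  filter_upwards [h.gibbsDensity_pos] with v hv
  have hl := h.perronFrobenius.1
  rw [← Real.log_mul hl.ne' hv.ne', gibbsDensity, mul_div_cancel₀ _ hl.ne', potential]

lemma potential_mul_ae_eq (h : IsHamiltonian μ H) (r : Mat k → ℝ) :
    (fun v => potential μ H v * r v) =ᵐ[μ] fun v =>
      Real.log (specRadius μ H) * r v + r v * Real.log (gibbsDensity μ H v) := by
  filter_upwards [h.potential_eq] with v hv
  rw [hv]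
  ring

variable {L : Mat k → Mat k}

lemma freeEnergy_of_integrable (h : IsHamiltonian μ H) (hL : L ∈ stochasticIrreducible μ)
    (hl : Integrable (fun v => stateDensity μ L v * Real.log (gibbsDensity μ H v)) μ) :
    freeEnergy μ H L = ((entropy μ L + (∫ v, stateDensity μ L v *
      Real.log (gibbsDensity μ H v) ∂μ) + Real.log (specRadius μ H) : ℝ) : EReal) := by
  have hM := isMarkovDensity_of_stochastic h.dim_pos hL
  have hr := hM.integrable_density.const_mul (Real.log (specRadius μ H))
  have hi : Integrable (fun v => potential μ H v * stateDensity μ L v) μ :=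
    (hr.add hl).congr (h.potential_mul_ae_eq _).symm
  rw [freeEnergy, extIntegral_of_integrable hi, ← EReal.coe_add,
    integral_congr_ae (h.potential_mul_ae_eq _), integral_add hr hl, integral_const_mul,
    hM.integral_density]
  congr 1
  ring

/-- For finite entropy the positive part of `U_H r_L` is always integrable, so that the free
energy is `-∞` as soon as `U_H r_L` is not integrable. -/
lemma freeEnergy_of_not_integrable (h : IsHamiltonian μ H) (hL : L ∈ stochasticIrreducible μ)
    (he : HasFiniteEntropy μ L)
    (hl : ¬ Integrable (fun v => stateDensity μ L v * Real.log (gibbsDensity μ H v)) μ) :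
    freeEnergy μ H L = ⊥ := by
  have := h.sigmaFinite
  have hM := isMarkovDensity_of_stochastic h.dim_pos hL
  have hr := hM.integrable_density.const_mul (Real.log (specRadius μ H))
  have hmeas : Measurable fun v => Real.log (specRadius μ H) * stateDensity μ L v
      + stateDensity μ L v * Real.log (gibbsDensity μ H v) :=
    (hM.measurable_density.const_mul _).add
      (hM.measurable_density.mul (Real.measurable_log.comp h.measurable_gibbsDensity))
  have hfm : AEStronglyMeasurable (fun v => potential μ H v * stateDensity μ L v) μ :=
    hmeas.aestronglyMeasurable.congr (h.potential_mul_ae_eq _).symm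
  rw [freeEnergy, extIntegral_of_not_integrable hfm, EReal.add_bot]
  · have hp := hM.integrable_posPart h.measurable_gibbsDensity h.gibbsDensity_nonneg
      h.gibbsDensity_pos h.integrable_gibbsDensity he
    refine (hr.norm.add hp).mono' (hfm.aemeasurable.max aemeasurable_const).aestronglyMeasurable ?_
    filter_upwards [h.potential_mul_ae_eq (stateDensity μ L)] with v hv
    rw [Real.norm_of_nonneg (le_max_right _ _), hv]
    have h1 := Real.le_norm_self (Real.log (specRadius μ H) * stateDensity μ L v)
    have h2 := hM.density_nonneg v
    have h3 := mul_le_mul_of_nonneg_left (le_max_left (Real.log (gibbsDensity μ H v)) 0) h2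
    have h4 := mul_nonneg h2 (le_max_right (Real.log (gibbsDensity μ H v)) 0)
    have h5 := norm_nonneg (Real.log (specRadius μ H) * stateDensity μ L v)
    exact max_le (add_le_add h1 h3) (add_nonneg h5 h4)
  · intro hi
    refine hl ?_
    refine ((hi.congr (h.potential_mul_ae_eq _)).sub hr).congr (.of_forall fun v => ?_)
    simp only [Pi.sub_apply]
    ring

/-- The free energy of `L` is `log λ_H` minus the relative entropy of `P_L` with respect to
`q_H`. -/
lemma freeEnergy_eq_sub_relEntropy (h : IsHamiltonian μ H) (hL : L ∈ stochasticIrreducible μ)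
    (he : HasFiniteEntropy μ L)
    (hl : Integrable (fun v => stateDensity μ L v * Real.log (gibbsDensity μ H v)) μ) :
    freeEnergy μ H L = ((Real.log (specRadius μ H) - ∫ x, relEntropyIntegrand (stateDensity μ L)
      (transition μ L) (gibbsDensity μ H) x ∂μ.prod μ : ℝ) : EReal) := by
  have := h.sigmaFinite
  have hM := isMarkovDensity_of_stochastic h.dim_pos hL
  rw [h.freeEnergy_of_integrable hL hl, hM.integral_relEntropy h.measurable_gibbsDensity
    h.gibbsDensity_pos h.integrable_gibbsDensity h.integral_gibbsDensity he hl, entropy]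
  congr 1
  simp only [entropyIntegrand]
  ring

lemma freeEnergy_le (h : IsHamiltonian μ H) (hL : L ∈ stochasticIrreducible μ)
    (he : HasFiniteEntropy μ L) : freeEnergy μ H L ≤ (Real.log (specRadius μ H) : EReal) := by
  by_cases hl : Integrable (fun v => stateDensity μ L v * Real.log (gibbsDensity μ H v)) μ
  · rw [h.freeEnergy_eq_sub_relEntropy hL he hl, EReal.coe_le_coe_iff, sub_le_self_iff]
    exact integral_nonneg ((isMarkovDensity_of_stochastic h.dim_pos hL).relEntropyIntegrand_nonneg
      h.gibbsDensity_nonneg)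
  · rw [h.freeEnergy_of_not_integrable hL he hl]
    exact bot_le

lemma freeEnergy_eq_iff (h : IsHamiltonian μ H) (hL : L ∈ stochasticIrreducible μ)
    (he : HasFiniteEntropy μ L) :
    freeEnergy μ H L = (Real.log (specRadius μ H) : EReal) ↔ GibbsIdentity μ H L := by
  have := h.sigmaFinite
  have hM := isMarkovDensity_of_stochastic h.dim_pos hL
  have key (hl : Integrable (fun v => stateDensity μ L v * Real.log (gibbsDensity μ H v)) μ) :
      freeEnergy μ H L = (Real.log (specRadius μ H) : EReal) ↔ GibbsIdentity μ H L := by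
    rw [h.freeEnergy_eq_sub_relEntropy hL he hl, EReal.coe_eq_coe_iff, sub_eq_self]
    exact hM.integral_relEntropy_eq_zero_iff h.measurable_gibbsDensity h.gibbsDensity_nonneg
      h.gibbsDensity_pos (hM.integrable_relEntropy h.measurable_gibbsDensity h.gibbsDensity_pos
        h.integrable_gibbsDensity he hl)
  constructor
  · intro hF
    by_cases hl : Integrable (fun v => stateDensity μ L v * Real.log (gibbsDensity μ H v)) μ
    · exact (key hl).mp hF
    · rw [h.freeEnergy_of_not_integrable hL he hl] at hF
      exact absurd hF (EReal.bot_ne_coe _)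
  · intro hG
    exact (key (hM.integrable_mul_log_of_ae_eq h.measurable_gibbsDensity he hG)).mpr hG

end IsHamiltonian

end Hamiltonian

end QChannel

/-! ### Mixtures of the cyclic shift and the sign flip -/

namespace QChannel

variable {k : ℕ} {μ : Measure (Mat k)}

lemma shiftMatrix_mul_conjTranspose (k : ℕ) : shiftMatrix k * (shiftMatrix k)ᴴ = 1 := by
  ext i j
  simp [shiftMatrix, Matrix.mul_apply, Matrix.one_apply, eq_comm]

lemma flipMatrix_mul_conjTranspose (k : ℕ) : flipMatrix k * (flipMatrix k)ᴴ = 1 := by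
  rw [flipMatrix, diagonal_conjTranspose, diagonal_mul_diagonal, ← diagonal_one]
  congr 1
  funext i
  by_cases h : (i : ℕ) + 1 = k <;> simp [h]

/-- The only projections whose range is invariant under both the cyclic shift and the sign flip are
`0` and `1`: the range of such a projection either contains the last basis vector or is
orthogonal to it, and the shift carries this over to all the others. -/
lemma eq_zero_or_eq_one_of_invariant {n : ℕ} {p : Mat (n + 1)}
    (hQ : (1 - p) * flipMatrix (n + 1) * p = 0) (hP : (1 - p) * shiftMatrix (n + 1) * p = 0)
    (hp : p * p = p) : p = 0 ∨ p = 1 := by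
  have hPp : shiftMatrix (n + 1) * p = p * shiftMatrix (n + 1) * p := by
    rw [Matrix.sub_mul, Matrix.sub_mul, Matrix.one_mul, sub_eq_zero] at hP
    exact hP
  -- `Q = 1 - 2 |last⟩⟨last|`, so invariance under `Q` is invariance under `|last⟩⟨last|`
  have hflip : flipMatrix (n + 1)
      = 1 - (2 : ℂ) • Matrix.single (Fin.last n) (Fin.last n) (1 : ℂ) := by
    ext i j
    by_cases hij : i = j
    · subst hij
      by_cases hi : i = Fin.last n
      · subst hi
        simp [flipMatrix]
        norm_num
      · have h1 : (i : ℕ) ≠ n := fun h => hi (Fin.ext h)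
        simp [flipMatrix, h1, Ne.symm hi]
    · simp only [flipMatrix, Matrix.diagonal_apply, hij, if_false, Matrix.sub_apply,
        Matrix.one_apply, Matrix.smul_apply, Matrix.single_apply]
      rw [if_neg]
      · simp
      · rintro ⟨rfl, rfl⟩
        exact hij rfl
  have h0 : (1 - p) * p = 0 := by rw [Matrix.sub_mul, Matrix.one_mul, hp, sub_self]
  have hE : (1 - p) * Matrix.single (Fin.last n) (Fin.last n) (1 : ℂ) * p = 0 := by
    rw [hflip, Matrix.mul_sub, Matrix.mul_one, Matrix.sub_mul, h0, zero_sub, neg_eq_zero,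
      Matrix.mul_smul, Matrix.smul_mul] at hQ
    exact (smul_eq_zero.mp hQ).resolve_left two_ne_zero
  have hentry : ∀ i j, (1 - p) i (Fin.last n) * p (Fin.last n) j = 0 := by
    intro i j
    have := congrFun (congrFun hE i) j
    rw [Matrix.mul_assoc, Matrix.mul_apply, Finset.sum_eq_single (Fin.last n)] at this
    · simpa [Matrix.single_mul_apply_same] using this
    · intro l _ hl
      rw [Matrix.single_mul_apply_of_ne _ _ _ _ _ hl, mul_zero]
    · simp
  have hrow : ∀ (M : Mat (n + 1)) i j, (shiftMatrix (n + 1) * M) i j = M (i + 1) j := by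
    intro M i j
    simp [shiftMatrix, Matrix.mul_apply]
  have hcol : ∀ (M : Mat (n + 1)) i j, (M * shiftMatrix (n + 1)) i (j + 1) = M i j := by
    intro M i j
    simp [shiftMatrix, Matrix.mul_apply]
  -- either row `last` of `p` vanishes, or column `last` of `1 - p` does
  by_cases hlast : ∀ j, p (Fin.last n) j = 0
  · left
    have hstep : ∀ i, (∀ j, p i j = 0) → ∀ j, p (i + 1) j = 0 := by
      intro i hi j
      rw [← hrow p i j, hPp, Matrix.mul_assoc, Matrix.mul_apply]
      simp [hi]
    have hall : ∀ i, ∀ j, p i j = 0 := by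
      intro i
      induction i using Fin.induction with
      | zero => simpa using hstep _ hlast
      | succ i ih => simpa using hstep _ ih
    exact Matrix.ext hall
  · right
    push Not at hlast
    obtain ⟨j, hj⟩ := hlast
    have hl : ∀ i, (1 - p) i (Fin.last n) = 0 := fun i =>
      (mul_eq_zero.mp (hentry i j)).resolve_right hj
    have hstep : ∀ m, (∀ i, (1 - p) i (m + 1) = 0) → ∀ i, (1 - p) i m = 0 := by
      intro m hm i
      have e1 : (1 - p) * shiftMatrix (n + 1) = (1 - p) * shiftMatrix (n + 1) * (1 - p) := by
        rw [Matrix.mul_sub ((1 - p) * shiftMatrix (n + 1)), hP, sub_zero, Matrix.mul_one]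
      rw [← hcol (1 - p) i m, e1, Matrix.mul_apply]
      simp only [hm, mul_zero, Finset.sum_const_zero]
    have hall : ∀ m, ∀ i, (1 - p) i m = 0 := by
      intro m
      induction m using Fin.reverseInduction with
      | last => exact hl
      | cast m ih =>
        refine hstep _ ?_
        simpa using ih
    have : 1 - p = 0 := Matrix.ext fun i m => hall m i
    exact (sub_eq_zero.mp this).symm

open Classical in
/-- The flip on `O` and the shift outside `O`. -/
noncomputable def flipOrShift (O : Set (Mat k)) (v : Mat k) : Mat k :=
  if v ∈ O then flipMatrix k else shiftMatrix k

/-- The map `v ↦ √(g v) Q` on `O` and `v ↦ √(g v) P` outside `O`. -/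
noncomputable def unitaryMixture (g : Mat k → ℝ) (O : Set (Mat k)) (v : Mat k) : Mat k :=
  ((Real.sqrt (g v) : ℝ) : ℂ) • flipOrShift O v

lemma gibbsMap_eq (μ : Measure (Mat k)) (H : Mat k → Mat k) (O : Set (Mat k)) :
    gibbsMap μ H O = unitaryMixture (gibbsDensity μ H) O :=
  rfl

lemma flipOrShift_mul_conjTranspose (O : Set (Mat k)) (v : Mat k) :
    flipOrShift O v * (flipOrShift O v)ᴴ = 1 := by
  unfold flipOrShift
  split_ifs
  · exact flipMatrix_mul_conjTranspose k
  · exact shiftMatrix_mul_conjTranspose k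

lemma measurable_flipOrShift {O : Set (Mat k)} (hO : IsOpen O) : Measurable (flipOrShift O) := by
  classical
  have : flipOrShift O = fun v => if v ∈ O then flipMatrix k else shiftMatrix k := by
    funext v
    unfold flipOrShift
    congr
  rw [this]
  exact Measurable.ite hO.measurableSet measurable_const measurable_const

/-- `g` is a probability density charging both the open set `O` and its complement, so that the
mixture of the flip and the shift is irreducible. For `k = 1` every map is irreducible, and no
condition on the masses is made. -/
structure IsMixtureDensity (μ : Measure (Mat k)) (O : Set (Mat k)) (g : Mat k → ℝ) : Prop where
  dim_pos : 0 < k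
  isOpen : IsOpen O
  measurable : Measurable g
  nonneg : ∀ v, 0 ≤ g v
  integrable : Integrable g μ
  integral_eq_one : ∫ v, g v ∂μ = 1
  mass_pos : k = 1 ∨ (0 < ∫ v in O, g v ∂μ ∧ 0 < ∫ v in Oᶜ, g v ∂μ)

lemma trace_one_re (k : ℕ) : (1 : Mat k).trace.re = k := by simp

namespace IsMixtureDensity

variable {O : Set (Mat k)} {g : Mat k → ℝ}

lemma mul_mul_conjTranspose (h : IsMixtureDensity μ O g) (X : Mat k) (v : Mat k) :
    unitaryMixture g O v * X * (unitaryMixture g O v)ᴴ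
      = (g v : ℂ) • (flipOrShift O v * X * (flipOrShift O v)ᴴ) := by
  rw [unitaryMixture, conjTranspose_smul, Matrix.mul_smul, Matrix.smul_mul, Matrix.smul_mul,
    smul_smul, Complex.star_def, Complex.conj_ofReal, ← Complex.ofReal_mul,
    Real.mul_self_sqrt (h.nonneg v)]

lemma mul_smul_one_mul (h : IsMixtureDensity μ O g) (c : ℂ) (v : Mat k) :
    unitaryMixture g O v * (c • (1 : Mat k)) * (unitaryMixture g O v)ᴴ
      = ((g v : ℂ) * c) • (1 : Mat k) := by
  rw [h.mul_mul_conjTranspose, Matrix.mul_smul, Matrix.smul_mul, Matrix.mul_one,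
    flipOrShift_mul_conjTranspose, smul_smul]

lemma squareIntegrable (h : IsMixtureDensity μ O g) : SquareIntegrable μ (unitaryMixture g O) := by
  refine ⟨?_, ?_⟩
  · have hs : Measurable fun v => ((Real.sqrt (g v) : ℝ) : ℂ) :=
      Complex.measurable_ofReal.comp (Real.continuous_sqrt.measurable.comp h.measurable)
    have hc : Continuous fun x : ℂ × Mat k => x.1 • x.2 := continuous_fst.smul continuous_snd
    exact hc.measurable.comp (hs.prodMk (measurable_flipOrShift h.isOpen))
  · refine (h.integrable.mul_const (k : ℝ)).congr (.of_forall fun v => ?_)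
    have e := h.mul_smul_one_mul 1 v
    simp only [one_smul, mul_one] at e
    have hn : 0 ≤ g v * k := mul_nonneg (h.nonneg v) (Nat.cast_nonneg k)
    have ht : (((g v : ℂ)) • (1 : Mat k)).trace.re = g v * k := by
      rw [trace_smul, smul_eq_mul, Complex.re_ofReal_mul, trace_one_re]
    simp only [hsNorm, e, ht]
    rw [Real.sq_sqrt hn]

lemma channel_eq (h : IsMixtureDensity μ O g) (X : Mat k) :
    channel μ (unitaryMixture g O) X
      = ((∫ v in O, g v ∂μ : ℝ) : ℂ) • (flipMatrix k * X * (flipMatrix k)ᴴ)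
        + ((∫ v in Oᶜ, g v ∂μ : ℝ) : ℂ) • (shiftMatrix k * X * (shiftMatrix k)ᴴ) := by
  rw [channel_apply h.squareIntegrable]
  ext i j
  have hm := h.isOpen.measurableSet
  have hi := h.squareIntegrable.entry X i j
  simp only [matIntegral, Matrix.of_apply, Matrix.add_apply, Matrix.smul_apply, smul_eq_mul]
  rw [← integral_add_compl hm hi]
  simp only [h.mul_mul_conjTranspose, Matrix.smul_apply, smul_eq_mul]
  congr 1
  · rw [← integral_complex_ofReal, ← integral_mul_const]
    refine setIntegral_congr_fun hm fun v hv => ?_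
    simp only [flipOrShift, hv, if_true]
  · rw [← integral_complex_ofReal, ← integral_mul_const]
    refine setIntegral_congr_fun hm.compl fun v hv => ?_
    have hv' : v ∉ O := hv
    simp only [flipOrShift, hv', if_false]

lemma channel_one (h : IsMixtureDensity μ O g) : channel μ (unitaryMixture g O) 1 = 1 := by
  rw [h.channel_eq, Matrix.mul_one, Matrix.mul_one, flipMatrix_mul_conjTranspose,
    shiftMatrix_mul_conjTranspose, ← add_smul, ← Complex.ofReal_add,
    integral_add_compl h.isOpen.measurableSet h.integrable, h.integral_eq_one,
    Complex.ofReal_one, one_smul]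

lemma dualChannel_one (h : IsMixtureDensity μ O g) :
    dualChannel μ (unitaryMixture g O) 1 = 1 := by
  rw [dualChannel_apply h.squareIntegrable]
  have e : ∀ v, (unitaryMixture g O v)ᴴ * 1 * unitaryMixture g O v = (g v : ℂ) • (1 : Mat k) := by
    intro v
    have hu : (flipOrShift O v)ᴴ * flipOrShift O v = 1 :=
      mul_eq_one_comm.mp (flipOrShift_mul_conjTranspose O v)
    rw [unitaryMixture, conjTranspose_smul, Matrix.mul_one, Matrix.mul_smul, Matrix.smul_mul,
      smul_smul, Complex.star_def, Complex.conj_ofReal, ← Complex.ofReal_mul,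
      Real.mul_self_sqrt (h.nonneg v), hu]
  ext i j
  simp only [e, matIntegral, Matrix.of_apply, Matrix.smul_apply, smul_eq_mul]
  rw [integral_mul_const, integral_complex_ofReal, h.integral_eq_one, Complex.ofReal_one, one_mul]

lemma isIrreducible (h : IsMixtureDensity μ O g) :
    IsIrreducible (channel μ (unitaryMixture g O)) := by
  rintro ⟨c, p, hc, hp, hp0, hp1, hle⟩
  have hpp : p * p = p := hp.isIdempotentElem
  rcases h.mass_pos with rfl | ⟨ha, hb⟩
  · have h1 := congrFun (congrFun hpp 0) 0
    simp only [Matrix.mul_apply, Fin.sum_univ_one] at h1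
    rcases mul_left_eq_self₀.mp h1 with h2 | h2
    · refine hp1 (Matrix.ext fun i j => ?_)
      rw [Subsingleton.elim i 0, Subsingleton.elim j 0, h2, one_apply_eq]
    · refine hp0 (Matrix.ext fun i j => ?_)
      rw [Subsingleton.elim i 0, Subsingleton.elim j 0, h2, Matrix.zero_apply]
  · have hps := posSemidef_of_isStarProjection hp
    have hqs := posSemidef_of_isStarProjection hp.one_sub
    have hQ := hps.mul_mul_conjTranspose_same (flipMatrix k)
    have hP := hps.mul_mul_conjTranspose_same (shiftMatrix k)
    have h0 : (1 - p) * p = 0 := by rw [Matrix.sub_mul, Matrix.one_mul, hpp, sub_self]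
    have h1 := (Complex.le_def.mp (trace_mul_nonneg hqs hle)).1
    rw [Matrix.mul_sub, Matrix.mul_smul, h0, smul_zero, zero_sub, trace_neg, h.channel_eq,
      Matrix.mul_add, trace_add, Matrix.mul_smul, Matrix.mul_smul, trace_smul, trace_smul,
      smul_eq_mul, smul_eq_mul, Complex.neg_re, Complex.add_re, Complex.re_ofReal_mul,
      Complex.re_ofReal_mul, Complex.zero_re] at h1
    have h2 := trace_mul_nonneg hqs hQ
    have h3 := trace_mul_nonneg hqs hP
    have h2' := (Complex.le_def.mp h2).1
    have h3' := (Complex.le_def.mp h3).1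
    rw [Complex.zero_re] at h2' h3'
    have h4 := mul_nonneg ha.le h2'
    have h5 := mul_nonneg hb.le h3'
    have h6 : ((1 - p) * (flipMatrix k * p * (flipMatrix k)ᴴ)).trace.re = 0 :=
      (mul_eq_zero.mp (by linarith : _ * _ = (0 : ℝ))).resolve_left ha.ne'
    have h7 : ((1 - p) * (shiftMatrix k * p * (shiftMatrix k)ᴴ)).trace.re = 0 :=
      (mul_eq_zero.mp (by linarith : _ * _ = (0 : ℝ))).resolve_left hb.ne'
    have hinv : ∀ U : Mat k, U * Uᴴ = 1 → ((1 - p) * (U * p * Uᴴ)).trace.re = 0 →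
        (1 - p) * U * p = 0 := by
      intro U hU ht
      have hA := hps.mul_mul_conjTranspose_same U
      have ht' : ((1 - p) * (U * p * Uᴴ)).trace = 0 :=
        Complex.ext ht (Complex.le_def.mp (trace_mul_nonneg hqs hA)).2.symm
      have h8 := hqs.mul_eq_zero_of_trace_mul_eq_zero hA ht'
      have hU' : Uᴴ * U = 1 := mul_eq_one_comm.mp hU
      calc (1 - p) * U * p = (1 - p) * (U * p * Uᴴ) * U := by
            rw [Matrix.mul_assoc (1 - p) (U * p * Uᴴ), Matrix.mul_assoc (U * p), hU',
              Matrix.mul_one, Matrix.mul_assoc]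
        _ = 0 := by rw [h8, Matrix.zero_mul]
    obtain ⟨n, rfl⟩ := Nat.exists_eq_add_of_lt h.dim_pos
    rw [zero_add] at *
    rcases eq_zero_or_eq_one_of_invariant (hinv _ (flipMatrix_mul_conjTranspose _) h6)
      (hinv _ (shiftMatrix_mul_conjTranspose _) h7) hpp with h8 | h8
    · exact hp0 h8
    · exact hp1 h8

lemma mem_stochasticIrreducible (h : IsMixtureDensity μ O g) :
    unitaryMixture g O ∈ stochasticIrreducible μ :=
  ⟨h.squareIntegrable, h.isIrreducible, h.dualChannel_one⟩

lemma rhoOf_eq (h : IsMixtureDensity μ O g) :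
    rhoOf μ (unitaryMixture g O) = ((k : ℂ)⁻¹) • (1 : Mat k) := by
  have hL := h.mem_stochasticIrreducible
  have hk : (0 : ℂ) < k := by exact_mod_cast h.dim_pos
  refine (perronFrobenius_of_stochastic h.dim_pos hL).2.1.unique
    (isEigenDensity_rhoOf h.dim_pos hL) ⟨PosDef.one.smul (inv_pos.mpr hk), ?_, ?_⟩
  · rw [trace_smul, trace_one, Fintype.card_fin, smul_eq_mul, inv_mul_cancel₀ hk.ne']
  · rw [map_smul, h.channel_one, specRadius_of_stochastic h.dim_pos hL, Complex.ofReal_one,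
      one_smul]

/-- The channel of the mixture is unital as well as trace preserving, so its invariant state is
`1 / k` and its outcomes are independent draws from `g`. -/
lemma stateDensity_eq (h : IsMixtureDensity μ O g) : stateDensity μ (unitaryMixture g O) = g := by
  funext v
  have hk : (k : ℂ) ≠ 0 := by exact_mod_cast h.dim_pos.ne'
  rw [stateDensity, h.rhoOf_eq, h.mul_smul_one_mul, trace_smul, trace_one, Fintype.card_fin,
    smul_eq_mul, mul_assoc, inv_mul_cancel₀ hk, mul_one, Complex.ofReal_re]

lemma transition_eq (h : IsMixtureDensity μ O g) {v : Mat k} (hv : g v ≠ 0) (w : Mat k) :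
    transition μ (unitaryMixture g O) v w = g w := by
  have hk : (k : ℂ) ≠ 0 := by exact_mod_cast h.dim_pos.ne'
  have hρ := (isEigenDensity_rhoOf h.dim_pos h.mem_stochasticIrreducible).1.posSemidef
  have e := stateDensity_mul_transition hρ v w
  rw [h.stateDensity_eq, h.rhoOf_eq, h.mul_smul_one_mul, h.mul_smul_one_mul, trace_smul, trace_one,
    Fintype.card_fin, smul_eq_mul, mul_assoc, mul_assoc, inv_mul_cancel₀ hk, mul_one,
    ← Complex.ofReal_mul, Complex.ofReal_re, mul_comm (g w)] at e
  exact mul_left_cancel₀ hv e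

lemma entropyIntegrand_eq (h : IsMixtureDensity μ O g) :
    entropyIntegrand μ (unitaryMixture g O) = fun x => g x.1 * (g x.2 * Real.log (g x.2)) := by
  funext x
  rw [entropyIntegrand, h.stateDensity_eq]
  by_cases hx : g x.1 = 0
  · simp [hx]
  · rw [h.transition_eq hx]

lemma hasFiniteEntropy_iff [SFinite μ] (h : IsMixtureDensity μ O g) :
    HasFiniteEntropy μ (unitaryMixture g O) ↔ Integrable (fun v => g v * Real.log (g v)) μ := by
  rw [HasFiniteEntropy, h.entropyIntegrand_eq]
  constructor
  · intro hi
    have h1 := hi.prod_right_ae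
    -- a single slice with `g v ≠ 0` already carries the integrability of `g log g`
    have h2 : ∃ᵐ v ∂μ, g v ≠ 0 := by
      intro h0
      have h3 : g =ᵐ[μ] 0 := by
        filter_upwards [h0] with v hv
        simpa using hv
      have h4 := h.integral_eq_one
      rw [integral_eq_zero_of_ae h3] at h4
      exact zero_ne_one h4
    obtain ⟨v, hv, hiv⟩ := (h2.and_eventually h1).exists
    exact (integrable_const_mul_iff (isUnit_iff_ne_zero.mpr hv) _).mp hiv
  · intro hi
    exact h.integrable.mul_prod hi

lemma entropy_eq [SFinite μ] (h : IsMixtureDensity μ O g) :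
    entropy μ (unitaryMixture g O) = - ∫ v, g v * Real.log (g v) ∂μ := by
  rw [entropy, h.entropyIntegrand_eq]
  have := integral_prod_mul (μ := μ) (ν := μ) g (fun v => g v * Real.log (g v))
  rw [this, h.integral_eq_one, one_mul]

end IsMixtureDensity

/-- If `H` is almost everywhere equal to one matrix `A`, which is the case for `μ` concentrated at a
point, then `φ_H` is a multiple of `X ↦ A X A†`, and the projection onto an eigenvector of `A` contradicts irreducibility. -/
lemma IsHamiltonian.not_ae_const {H : Mat k → Mat k} (h : IsHamiltonian μ H) (hk : k ≠ 1)
    (A : Mat k) : ¬ ∀ᵐ v ∂μ, H v = A := by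
  intro hA
  have : Nonempty (Fin k) := ⟨⟨0, h.dim_pos⟩⟩
  have hφ : ∀ X, channel μ H X = ((μ.real Set.univ : ℝ) : ℂ) • (A * X * Aᴴ) := by
    intro X
    rw [channel_apply h.squareIntegrable]
    ext i j
    simp only [matIntegral, Matrix.of_apply, Matrix.smul_apply]
    have : (fun v => (H v * X * (H v)ᴴ) i j) =ᵐ[μ] fun _ => (A * X * Aᴴ) i j := by
      filter_upwards [hA] with v hv
      rw [hv]
    rw [integral_congr_ae this, integral_const, Complex.real_smul, smul_eq_mul]
  obtain ⟨α, hα⟩ := Module.End.exists_eigenvalue (Matrix.toLin' A)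
  obtain ⟨x, hx⟩ := hα.exists_hasEigenvector
  have hAx : A *ᵥ x = α • x := by
    have := Module.End.mem_eigenspace_iff.mp hx.1
    rwa [Matrix.toLin'_apply] at this
  have hs0 : 0 < star x ⬝ᵥ x := dotProduct_star_self_pos_iff.mpr hx.2
  set s := star x ⬝ᵥ x with hs
  set p : Mat k := s⁻¹ • vecMulVec x (star x) with hp
  have hsreal : star s = s := by
    rw [Complex.star_def, Complex.conj_eq_iff_im]
    exact (Complex.lt_def.mp hs0).2.symm
  have hproj : IsStarProjection p := by
    refine ⟨?_, ?_⟩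
    · rw [IsIdempotentElem, hp, Matrix.smul_mul, Matrix.mul_smul, vecMulVec_mul_vecMulVec, ← hs,
        vecMulVec_smul, smul_smul s⁻¹ s, inv_mul_cancel₀ hs0.ne', one_smul]
    · rw [IsSelfAdjoint, hp, star_smul, star_inv₀, hsreal, star_eq_conjTranspose,
        conjTranspose_vecMulVec, star_star]
  have htr : p.trace = 1 := by
    rw [hp, trace_smul, trace_vecMulVec, dotProduct_comm, ← hs, smul_eq_mul,
      inv_mul_cancel₀ hs0.ne']
  have hApA : A * p * Aᴴ = ((‖α‖ ^ 2 : ℝ) : ℂ) • p := by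
    have e : A * vecMulVec x (star x) * Aᴴ = (α * star α) • vecMulVec x (star x) := by
      rw [mul_vecMulVec, hAx, vecMulVec_mul, ← star_mulVec, hAx, star_smul, smul_vecMulVec,
        vecMulVec_smul, smul_smul]
    rw [hp, Matrix.mul_smul, Matrix.smul_mul, e, smul_comm, Complex.star_def, Complex.mul_conj,
      Complex.normSq_eq_norm_sq]
  clear_value p
  refine h.irreducible ⟨μ.real Set.univ * ‖α‖ ^ 2 + 1, p, by positivity, hproj, ?_, ?_, ?_⟩
  · intro h0
    rw [h0, trace_zero] at htr
    exact zero_ne_one htr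
  · intro h1
    rw [h1, trace_one, Fintype.card_fin] at htr
    exact hk (by exact_mod_cast htr)
  · rw [hφ, hApA, smul_smul, ← Complex.ofReal_mul, Complex.ofReal_add, add_smul,
      add_sub_cancel_left, Complex.ofReal_one, one_smul]
    exact posSemidef_of_isStarProjection hproj

/-- An open set `O` such that both `O` and its complement have positive mass, when `k ≠ 1`: the
support of `μ` has at least two points, and `O` is a neighbourhood separating one from another. -/
lemma IsHamiltonian.exists_isOpen {H : Mat k → Mat k} (h : IsHamiltonian μ H) :
    ∃ O : Set (Mat k), IsOpen O ∧ (k = 1 ∨ (μ O ≠ 0 ∧ μ Oᶜ ≠ 0)) := by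
  by_cases hk : k = 1
  · exact ⟨∅, isOpen_empty, .inl hk⟩
  obtain ⟨v, -, hv⟩ := exists_mem_forall_mem_nhdsWithin_pos_measure (μ := μ) (s := Set.univ)
    (by simpa using h.measure_ne_zero)
  have hv' : μ {v}ᶜ ≠ 0 := by
    intro h0
    refine h.not_ae_const hk (H v) ?_
    filter_upwards [measure_eq_zero_iff_ae_notMem.mp h0] with w hw
    rw [Set.mem_compl_iff, not_not, Set.mem_singleton_iff] at hw
    rw [hw]
  obtain ⟨w, hwv, hw⟩ := exists_mem_forall_mem_nhdsWithin_pos_measure hv'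
  obtain ⟨U, V, hU, hV, hvU, hwV, hUV⟩ := t2_separation (Ne.symm hwv : v ≠ w)
  refine ⟨U, hU, .inr ⟨(hv U ?_).ne', ?_⟩⟩
  · exact mem_nhdsWithin_of_mem_nhds (hU.mem_nhds hvU)
  · have h1 := hw V (mem_nhdsWithin_of_mem_nhds (hV.mem_nhds hwV))
    exact (h1.trans_le (measure_mono hUV.subset_compl_left)).ne'

end QChannel

/-! ### The pressure -/

namespace QChannel

variable {k : ℕ} {μ : Measure (Mat k)}

namespace IsHamiltonian

variable {H : Mat k → Mat k}

/-- The level sets `{1/(n+1) ≤ q_H ≤ n+1}`. -/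
def truncationSet (μ : Measure (Mat k)) (H : Mat k → Mat k) (n : ℕ) : Set (Mat k) :=
  {v | ((n : ℝ) + 1)⁻¹ ≤ gibbsDensity μ H v ∧ gibbsDensity μ H v ≤ (n : ℝ) + 1}

lemma measurableSet_truncationSet (h : IsHamiltonian μ H) (n : ℕ) :
    MeasurableSet (truncationSet μ H n) :=
  (measurableSet_le measurable_const h.measurable_gibbsDensity).inter
    (measurableSet_le h.measurable_gibbsDensity measurable_const)

lemma monotone_truncationSet : Monotone (truncationSet μ H) := by
  intro m n hmn v hv
  have h1 : (m : ℝ) + 1 ≤ (n : ℝ) + 1 := by exact_mod_cast Nat.succ_le_succ hmn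
  have h2 : (0 : ℝ) < (m : ℝ) + 1 := by positivity
  exact ⟨(inv_anti₀ h2 h1).trans hv.1, hv.2.trans h1⟩

lemma mem_iUnion_truncationSet {v : Mat k} (hv : 0 < gibbsDensity μ H v) :
    v ∈ ⋃ n, truncationSet μ H n := by
  obtain ⟨n, hn⟩ := exists_nat_ge (max (gibbsDensity μ H v) (gibbsDensity μ H v)⁻¹)
  refine Set.mem_iUnion.mpr ⟨n, ?_, ?_⟩
  · rw [inv_le_comm₀ (by positivity) hv]
    exact (le_max_right _ _).trans (hn.trans (by linarith))
  · exact (le_max_left _ _).trans (hn.trans (by linarith))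

lemma tendsto_setIntegral_truncationSet (h : IsHamiltonian μ H) {s : Set (Mat k)}
    (hs : MeasurableSet s) :
    Filter.Tendsto (fun n => ∫ v in s ∩ truncationSet μ H n, gibbsDensity μ H v ∂μ) Filter.atTop
      (nhds (∫ v in s, gibbsDensity μ H v ∂μ)) := by
  have h1 := tendsto_setIntegral_of_monotone (μ := μ) (f := gibbsDensity μ H)
    (s := fun n => s ∩ truncationSet μ H n)
    (fun n => hs.inter (h.measurableSet_truncationSet n))
    (fun m n hmn => Set.inter_subset_inter_right _ (monotone_truncationSet hmn))
    h.integrable_gibbsDensity.integrableOn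
  have h2 : (⋃ n, s ∩ truncationSet μ H n) =ᵐ[μ] s := by
    rw [← Set.inter_iUnion]
    filter_upwards [h.gibbsDensity_pos] with v hv
    have hv' := mem_iUnion_truncationSet hv
    exact propext ⟨fun hx => hx.1, fun hx => ⟨hx, hv'⟩⟩
  rwa [setIntegral_congr_set h2] at h1

/-- The mass of `q_H` on the `n`-th level set. -/
noncomputable def truncatedMass (μ : Measure (Mat k)) (H : Mat k → Mat k) (n : ℕ) : ℝ :=
  ∫ v in truncationSet μ H n, gibbsDensity μ H v ∂μ

/-- The density `q_H`, conditioned to the `n`-th level set. -/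
noncomputable def truncatedDensity (μ : Measure (Mat k)) (H : Mat k → Mat k) (n : ℕ) :
    Mat k → ℝ :=
  (truncationSet μ H n).indicator fun v => gibbsDensity μ H v / truncatedMass μ H n

lemma tendsto_truncatedMass (h : IsHamiltonian μ H) :
    Filter.Tendsto (truncatedMass μ H) Filter.atTop (nhds 1) := by
  have h1 := h.tendsto_setIntegral_truncationSet MeasurableSet.univ
  simp only [Set.univ_inter, setIntegral_univ, h.integral_gibbsDensity] at h1
  exact h1

lemma setIntegral_truncatedDensity (h : IsHamiltonian μ H) (n : ℕ) (s : Set (Mat k)) :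
    ∫ v in s, truncatedDensity μ H n v ∂μ
      = (∫ v in s ∩ truncationSet μ H n, gibbsDensity μ H v ∂μ) / truncatedMass μ H n := by
  rw [truncatedDensity, setIntegral_indicator (h.measurableSet_truncationSet n), integral_div]

lemma setIntegral_gibbsDensity_pos (h : IsHamiltonian μ H) {s : Set (Mat k)} (hs : μ s ≠ 0) :
    0 < ∫ v in s, gibbsDensity μ H v ∂μ := by
  rw [integral_pos_iff_support_of_nonneg h.gibbsDensity_nonneg
    h.integrable_gibbsDensity.integrableOn, pos_iff_ne_zero]
  intro h0
  rw [measure_eq_zero_iff_ae_notMem] at h0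
  refine hs ?_
  rw [← Measure.restrict_eq_zero, ← ae_eq_bot, ← Filter.eventually_false_iff_eq_bot]
  filter_upwards [h0, ae_restrict_of_ae h.gibbsDensity_pos] with v hv hv'
  exact hv hv'.ne'

lemma isMixtureDensity_gibbsDensity (h : IsHamiltonian μ H) {O : Set (Mat k)} (hO : IsOpen O)
    (hmass : k = 1 ∨ (μ O ≠ 0 ∧ μ Oᶜ ≠ 0)) : IsMixtureDensity μ O (gibbsDensity μ H) :=
  ⟨h.dim_pos, hO, h.measurable_gibbsDensity, h.gibbsDensity_nonneg, h.integrable_gibbsDensity,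
    h.integral_gibbsDensity, hmass.imp_right fun hm =>
      ⟨h.setIntegral_gibbsDensity_pos hm.1, h.setIntegral_gibbsDensity_pos hm.2⟩⟩

lemma eventually_isMixtureDensity (h : IsHamiltonian μ H) {O : Set (Mat k)} (hO : IsOpen O)
    (hmass : k = 1 ∨ (μ O ≠ 0 ∧ μ Oᶜ ≠ 0)) :
    ∀ᶠ n in Filter.atTop, 0 < truncatedMass μ H n ∧
      IsMixtureDensity μ O (truncatedDensity μ H n) := by
  have hev : ∀ s : Set (Mat k), MeasurableSet s → μ s ≠ 0 → ∀ᶠ n in Filter.atTop,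
      0 < ∫ v in s ∩ truncationSet μ H n, gibbsDensity μ H v ∂μ := fun s hs hs0 =>
    (h.tendsto_setIntegral_truncationSet hs).eventually_const_lt (h.setIntegral_gibbsDensity_pos hs0)
  have hmass' : ∀ᶠ n in Filter.atTop,
      k = 1 ∨ (0 < ∫ v in O ∩ truncationSet μ H n, gibbsDensity μ H v ∂μ ∧
        0 < ∫ v in Oᶜ ∩ truncationSet μ H n, gibbsDensity μ H v ∂μ) := by
    rcases hmass with hk | ⟨h1, h2⟩
    · exact .of_forall fun _ => .inl hk
    · filter_upwards [hev O hO.measurableSet h1, hev Oᶜ hO.measurableSet.compl h2] with n h3 h4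
      exact .inr ⟨h3, h4⟩
  filter_upwards [h.tendsto_truncatedMass.eventually_const_lt one_pos, hmass'] with n hZ hm
  have hE := h.measurableSet_truncationSet n
  refine ⟨hZ, h.dim_pos, hO, (h.measurable_gibbsDensity.div_const _).indicator hE, ?_,
    (h.integrable_gibbsDensity.div_const _).indicator hE, ?_, ?_⟩
  · exact Set.indicator_nonneg fun v _ => div_nonneg (h.gibbsDensity_nonneg v) hZ.le
  · rw [← setIntegral_univ, h.setIntegral_truncatedDensity, Set.univ_inter]
    exact div_self hZ.ne'
  · refine hm.imp_right fun hm => ?_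
    rw [h.setIntegral_truncatedDensity, h.setIntegral_truncatedDensity]
    exact ⟨div_pos hm.1 hZ, div_pos hm.2 hZ⟩

lemma truncatedDensity_mul_log {n : ℕ} (hZ : 0 < truncatedMass μ H n) (v : Mat k) :
    truncatedDensity μ H n v * Real.log (truncatedDensity μ H n v)
      = truncatedDensity μ H n v * Real.log (gibbsDensity μ H v)
        - Real.log (truncatedMass μ H n) * truncatedDensity μ H n v := by
  by_cases hv : v ∈ truncationSet μ H n
  · have hq : 0 < gibbsDensity μ H v := lt_of_lt_of_le (by positivity) hv.1
    rw [truncatedDensity, Set.indicator_of_mem hv, Real.log_div hq.ne' hZ.ne']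
    ring
  · rw [truncatedDensity, Set.indicator_of_notMem hv]
    ring

lemma integrable_truncatedDensity_mul_log (h : IsHamiltonian μ H) {n : ℕ} {O : Set (Mat k)}
    (hm : IsMixtureDensity μ O (truncatedDensity μ H n)) :
    Integrable (fun v => truncatedDensity μ H n v * Real.log (gibbsDensity μ H v)) μ := by
  refine (hm.integrable.mul_const (Real.log ((n : ℝ) + 1))).mono'
    (hm.measurable.mul (Real.measurable_log.comp h.measurable_gibbsDensity)).aestronglyMeasurable
    (.of_forall fun v => ?_)
  rw [norm_mul, Real.norm_of_nonneg (hm.nonneg v)]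
  by_cases hv : v ∈ truncationSet μ H n
  · refine mul_le_mul_of_nonneg_left ?_ (hm.nonneg v)
    have hn : (0 : ℝ) < ((n : ℝ) + 1)⁻¹ := by positivity
    have hq : 0 < gibbsDensity μ H v := hn.trans_le hv.1
    rw [Real.norm_eq_abs, abs_le]
    refine ⟨?_, Real.log_le_log hq hv.2⟩
    rw [← Real.log_inv]
    exact Real.log_le_log hn hv.1
  · rw [truncatedDensity, Set.indicator_of_notMem hv]
    simp

/-- The mixture with the truncated density has free energy `log λ_H + log Z_n`, where `Z_n` is
the mass of `q_H` on the level set. -/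
lemma freeEnergy_truncated (h : IsHamiltonian μ H) {n : ℕ} {O : Set (Mat k)}
    (hZ : 0 < truncatedMass μ H n) (hm : IsMixtureDensity μ O (truncatedDensity μ H n)) :
    HasFiniteEntropy μ (unitaryMixture (truncatedDensity μ H n) O) ∧
      freeEnergy μ H (unitaryMixture (truncatedDensity μ H n) O)
        = ((Real.log (specRadius μ H) + Real.log (truncatedMass μ H n) : ℝ) : EReal) := by
  have := h.sigmaFinite
  have hl := h.integrable_truncatedDensity_mul_log hm
  have hc := hm.integrable.const_mul (Real.log (truncatedMass μ H n))
  constructor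
  · rw [hm.hasFiniteEntropy_iff]
    simp only [truncatedDensity_mul_log hZ]
    exact hl.sub hc
  · rw [h.freeEnergy_of_integrable hm.mem_stochasticIrreducible
      (by rw [hm.stateDensity_eq]; exact hl), hm.entropy_eq, hm.stateDensity_eq]
    simp only [truncatedDensity_mul_log hZ]
    rw [integral_sub hl hc, integral_const_mul, hm.integral_eq_one]
    congr 1
    ring

theorem pressure_eq (h : IsHamiltonian μ H) :
    pressure μ H = (Real.log (specRadius μ H) : EReal) := by
  refine le_antisymm (iSup₂_le fun L hL => h.freeEnergy_le hL.1 hL.2) ?_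
  obtain ⟨O, hO, hmass⟩ := h.exists_isOpen
  have hlim : Filter.Tendsto (fun n => ((Real.log (specRadius μ H)
      + Real.log (truncatedMass μ H n) : ℝ) : EReal)) Filter.atTop
      (nhds (Real.log (specRadius μ H) : EReal)) := by
    refine (continuous_coe_real_ereal.tendsto _).comp ?_
    have := (h.tendsto_truncatedMass.log one_ne_zero).const_add (Real.log (specRadius μ H))
    rwa [Real.log_one, add_zero] at this
  refine le_of_tendsto hlim ?_
  filter_upwards [h.eventually_isMixtureDensity hO hmass] with n ⟨hZ, hm⟩
  obtain ⟨he, hF⟩ := h.freeEnergy_truncated hZ hm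
  rw [← hF]
  exact le_iSup₂ (f := fun L (_ : L ∈ {L | L ∈ stochasticIrreducible μ ∧ HasFiniteEntropy μ L}) =>
    freeEnergy μ H L) _ ⟨hm.mem_stochasticIrreducible, he⟩

theorem isGibbsChannel_iff (h : IsHamiltonian μ H) {L : Mat k → Mat k}
    (hL : L ∈ stochasticIrreducible μ) (he : HasFiniteEntropy μ L) :
    IsGibbsChannel μ H L ↔ GibbsIdentity μ H L := by
  rw [← h.freeEnergy_eq_iff hL he, ← h.pressure_eq]
  exact ⟨fun hG => hG.2.2, fun hF => ⟨hL, he, hF⟩⟩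

lemma integrable_mul_log_gibbsDensity_iff (h : IsHamiltonian μ H) :
    Integrable (fun v => gibbsDensity μ H v * Real.log (gibbsDensity μ H v)) μ ↔
      Integrable (fun v => hamWeight μ H v * potential μ H v) μ := by
  have hl := h.perronFrobenius.1
  have hc := h.integrable_gibbsDensity.const_mul (Real.log (specRadius μ H))
  have e : (fun v => hamWeight μ H v * potential μ H v) =ᵐ[μ] fun v =>
      specRadius μ H * (Real.log (specRadius μ H) * gibbsDensity μ H v
        + gibbsDensity μ H v * Real.log (gibbsDensity μ H v)) := by
    filter_upwards [h.potential_eq] with v hv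
    have : hamWeight μ H v = specRadius μ H * gibbsDensity μ H v := by
      rw [gibbsDensity, mul_div_cancel₀ _ hl.ne']
    rw [hv, this]
    ring
  rw [integrable_congr e, integrable_const_mul_iff (isUnit_iff_ne_zero.mpr hl.ne')]
  exact (integrable_add_iff_integrable_right hc).symm

end IsHamiltonian

end QChannel

theorem mainTheorem1 (k : ℕ) (hk : 0 < k) (μ : Measure (Mat k)) (hμ : μ ≠ 0)
    (H : Mat k → Mat k) (hsq : SquareIntegrable μ H) (hirr : IsIrreducible (channel μ H))
    (hne : ∀ᵐ v ∂μ, H v ≠ 0) :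
    -- the objects entering the pressure are well defined
    (0 < specRadius μ H ∧ (∃! ρ, IsEigenDensity μ H ρ) ∧ (∃! σ, IsDualEigenmatrix μ H σ) ∧
      (∀ L ∈ stochasticIrreducible μ, ∃! ρ, IsEigenDensity μ L ρ)) ∧
    -- the variational principle
    pressure μ H = (Real.log (specRadius μ H) : EReal) ∧
    -- when the supremum is attained
    (∀ L ∈ stochasticIrreducible μ, HasFiniteEntropy μ L →
      (IsGibbsChannel μ H L ↔ GibbsIdentity μ H L)) ∧
    -- the maximizer
    (∃ O : Set (Mat k), IsOpen O ∧ gibbsMap μ H O ∈ stochasticIrreducible μ ∧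
      GibbsIdentity μ H (gibbsMap μ H O) ∧
      (IsGibbsChannel μ H (gibbsMap μ H O) ↔
        Integrable (fun v => hamWeight μ H v * potential μ H v) μ)) := by
  have h : IsHamiltonian μ H := ⟨hk, hμ, hsq, hirr, hne⟩
  have := h.sigmaFinite
  obtain ⟨hpos, hρ, hσ⟩ := h.perronFrobenius
  refine ⟨⟨hpos, hρ, hσ, fun L hL => (perronFrobenius_of_stochastic hk hL).2.1⟩, h.pressure_eq,
    fun L hL he => h.isGibbsChannel_iff hL he, ?_⟩
  obtain ⟨O, hO, hmass⟩ := h.exists_isOpen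
  have hm := h.isMixtureDensity_gibbsDensity hO hmass
  have hid : GibbsIdentity μ H (unitaryMixture (gibbsDensity μ H) O) := by
    refine .of_forall fun v hv => .of_forall fun w => ?_
    rw [hm.stateDensity_eq] at hv
    rw [hm.transition_eq hv, gibbsDensity]
  refine ⟨O, hO, ?_⟩
  rw [gibbsMap_eq, ← h.integrable_mul_log_gibbsDensity_iff, ← hm.hasFiniteEntropy_iff]
  exact ⟨hm.mem_stochasticIrreducible, hid, fun hG => hG.2.1,
    fun he => (h.isGibbsChannel_iff hm.mem_stochasticIrreducible he).mpr hid⟩
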